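/- Fix real numbers $\beta,\mu$. A (quasiclassical) state $R=(\rho,H_R,N_R)$ consists of a density operator $\rho$, a Hamiltonian $H_R$ and a number operator $N_R$ on a finite-dimensional Hilbert space $\mathbb C^{d_R}$; $H_R$ and $N_R$ are Hermitian, and the three operators commute with each other. The equilibrium state of a system with operators $(H,N)$ is $\gamma=e^{-\beta(H-\mu N)}/Z$ with $Z=\operatorname{Tr}e^{-\beta(H-\mu N)}$. Along an orthonormal basis of common eigenvectors of $\rho,H_R,N_R$, let $r$ denote the vector of eigenvalues of $\rho$ and $g_R$ the vector of eigenvalues of $\gamma_R=e^{-\beta(H_R-\mu N_R)}/Z_R$; similarly $s,g_S$ for $S=(\sigma,H_S,N_S)$. An equilibrating operation from the system $(H_R,N_R)$ to the system $(H_S,N_S)$ consists of: drawing an equilibrium state $\gamma_G$ of a bath $(H_G,N_G)$ of finite dimension (with $[H_G,N_G]=0$); performing a unitary $U$ that commutes with $H_R\otimes 1+1\otimes H_G$ and with $N_R\otimes 1+1\otimes N_G$; and tracing out a subsystem $A$ that has its own Hamiltonian $H_A$ and number operator $N_A$, where, with respect to the decomposition of the composite into the remaining system and $A$, $H_R\otimes1+1\otimes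 H_G=H_S\otimes 1+1\otimes H_A$ and $N_R\otimes1+1\otimes N_G=N_S\otimes 1+1\otimes N_A$. It acts as $\rho\mapsto \operatorname{Tr}_A\bigl(U(\rho\otimes\gamma_G)U^\dagger\bigr)$. Write $R\xmapsto{\beta,\mu}S$ if $S$ is obtained from $R$ by equilibrating operations in the limit of growing baths: there is a sequence of equilibrating operations from $(H_R,N_R)$ to $(H_S,N_S)$, with finite-dimensional baths that may grow along the sequence, whose outputs on $\rho$ converge to $\sigma$. (In particular this holds if a single equilibrating operation maps $\rho$ exactly to $\sigma$.) Theorem. For all states $R$ and $S$, $R\xmapsto{\beta,\mu}S$ if and only if $R$ equimajorizes $S$, i.e. if and only if there is a $d_S\times d_R$ matrix $M$ with nonnegative entries such that $$Mr=s,\qquad Mg_R=g_S,\qquad \sum_{i=1}^{d_S}M_{ij}=1\quad\text{for all } j=1,\dots,d_R.$$ -/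

import Mathlib

open scoped Matrix Kronecker ComplexOrder

noncomputable section

namespace GrandPotential

/-- A finite-dimensional system, with Hilbert space `ℂ^ι`, that carries a Hamiltonian `H` and a
number operator `N` that commute with each other. -/
structure GPSystem (ι : Type) [Fintype ι] [DecidableEq ι] where
  /-- the Hamiltonian -/
  H : Matrix ι ι ℂ
  /-- the number operator -/
  N : Matrix ι ι ℂ
  H_hermitian : H.IsHermitian
  N_hermitian : N.IsHermitian
  commute_H_N : Commute H N

/-- A quasiclassical state `(ρ, H, N)`: a density operator `ρ` on a system, such that `ρ`, `H`, `N`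
commute with each other. -/
structure GPState (ι : Type) [Fintype ι] [DecidableEq ι] extends GPSystem ι where
  /-- the density operator -/
  ρ : Matrix ι ι ℂ
  ρ_posSemidef : ρ.PosSemidef
  ρ_trace : ρ.trace = 1
  commute_ρ_H : Commute ρ H
  commute_ρ_N : Commute ρ N

/-- The operator `X ⊗ 1 + 1 ⊗ Y` on a composite system: the total of an extensive quantity. -/
def total {ι κ : Type} [DecidableEq ι] [DecidableEq κ]
    (X : Matrix ι ι ℂ) (Y : Matrix κ κ ℂ) : Matrix (ι × κ) (ι × κ) ℂ :=
  X ⊗ₖ (1 : Matrix κ κ ℂ) + (1 : Matrix ι ι ℂ) ⊗ₖ Y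

/-- The partial trace over the second tensor factor. -/
def traceOut {κ α : Type} [Fintype α] (X : Matrix (κ × α) (κ × α) ℂ) : Matrix κ κ ℂ :=
  Matrix.of fun j j' => ∑ a, X (j, a) (j', a)

/-- The Boltzmann operator `exp (-β (H - μ N))` of a system. -/
def GPSystem.boltzmann {ι : Type} [Fintype ι] [DecidableEq ι] (X : GPSystem ι) (β μ : ℝ) :
    Matrix ι ι ℂ :=
  NormedSpace.exp (-(β : ℂ) • (X.H - (μ : ℂ) • X.N))

/-- The density operator `γ = exp (-β (H - μ N)) / Z`, with `Z = tr exp (-β (H - μ N))`, of the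
equilibrium (free) state of a system. -/
def GPSystem.equilibrium {ι : Type} [Fintype ι] [DecidableEq ι] (X : GPSystem ι) (β μ : ℝ) :
    Matrix ι ι ℂ :=
  (X.boltzmann β μ).trace⁻¹ • X.boltzmann β μ

/-- An equilibrating operation from a system `X` to a system `Y` (the parameters `β`, `μ` enter
only through the state of the bath, in `EquilibratingOperation.map`): the free state on a nonzero finite-dimensional system `bath` is drawn; a unitary
`U` that conserves the total energy and the total particle number is performed; and a subsystem
`discarded`, which has its own Hamiltonian and number operator, is traced out. That the composite
consists of the subsystems `Y` and `discarded` is expressed by a unitary `split` from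
`ℂ^ι ⊗ ℂ^bathIdx` onto `ℂ^κ ⊗ ℂ^discardedIdx`, under which `H_X + H_bath = H_Y + H_discarded` and
`N_X + N_bath = N_Y + N_discarded`. -/
structure EquilibratingOperation {ι κ : Type} [Fintype ι] [DecidableEq ι] [Fintype κ]
    [DecidableEq κ] (X : GPSystem ι) (Y : GPSystem κ) where
  bathIdx : Type
  [bathFintype : Fintype bathIdx]
  [bathDecidableEq : DecidableEq bathIdx]
  [bathNonempty : Nonempty bathIdx]
  bath : GPSystem bathIdx
  U : Matrix (ι × bathIdx) (ι × bathIdx) ℂ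
  U_unitary : U ∈ Matrix.unitaryGroup (ι × bathIdx) ℂ
  U_commute_H : Commute U (total X.H bath.H)
  U_commute_N : Commute U (total X.N bath.N)
  discardedIdx : Type
  [discardedFintype : Fintype discardedIdx]
  [discardedDecidableEq : DecidableEq discardedIdx]
  discarded : GPSystem discardedIdx
  split : Matrix (κ × discardedIdx) (ι × bathIdx) ℂ
  split_isometry : splitᴴ * split = 1
  split_coisometry : split * splitᴴ = 1
  split_H : split * total X.H bath.H * splitᴴ = total Y.H discarded.H
  split_N : split * total X.N bath.N * splitᴴ = total Y.N discarded.N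

attribute [instance] EquilibratingOperation.bathFintype EquilibratingOperation.bathDecidableEq
  EquilibratingOperation.bathNonempty EquilibratingOperation.discardedFintype
  EquilibratingOperation.discardedDecidableEq

/-- The action `ρ ↦ Tr_A (U (ρ ⊗ γ) U†)` of an equilibrating operation on operators, where `γ` is
the equilibrium state of the bath. -/
def EquilibratingOperation.map {ι κ : Type} [Fintype ι] [DecidableEq ι] [Fintype κ]
    [DecidableEq κ] {X : GPSystem ι} {Y : GPSystem κ} (O : EquilibratingOperation X Y) (β μ : ℝ)
    (ρ : Matrix ι ι ℂ) : Matrix κ κ ℂ :=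
  traceOut (O.split * (O.U * (ρ ⊗ₖ O.bath.equilibrium β μ) * O.Uᴴ) * O.splitᴴ)

/-- Equilibrating operations, in the grand-potential theory defined by `(β, μ)`, map `R` to `S`
when the bath may grow without bound: there is a sequence of equilibrating operations, each from
the system of `R` to exactly the system of `S`, whose outputs on `R` converge to the density
operator of `S`. (A single operation that maps `R` exactly to `S` is a constant sequence.) -/
def Converts {ι κ : Type} [Fintype ι] [DecidableEq ι] [Fintype κ] [DecidableEq κ]
    (β μ : ℝ) (R : GPState ι) (S : GPState κ) : Prop :=
  ∃ O : ℕ → EquilibratingOperation R.toGPSystem S.toGPSystem,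
    Filter.Tendsto (fun n => (O n).map β μ R.ρ) Filter.atTop (nhds S.ρ)

/-- A shared orthonormal eigenbasis of `ρ`, `H` and `N`: the columns of a unitary `W` that
diagonalizes all three. -/
structure GPState.Eigenbasis {ι : Type} [Fintype ι] [DecidableEq ι] (R : GPState ι) where
  W : Matrix ι ι ℂ
  W_unitary : W ∈ Matrix.unitaryGroup ι ℂ
  ρ_isDiag : (Wᴴ * R.ρ * W).IsDiag
  H_isDiag : (Wᴴ * R.H * W).IsDiag
  N_isDiag : (Wᴴ * R.N * W).IsDiag

/-- The state vector of `R`: the eigenvalues of `ρ`, listed along a shared eigenbasis. -/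
def GPState.Eigenbasis.stateVector {ι : Type} [Fintype ι] [DecidableEq ι] {R : GPState ι}
    (B : R.Eigenbasis) : ι → ℝ :=
  fun i => ((B.Wᴴ * R.ρ * B.W) i i).re

/-- The state vector of the equilibrium state associated with `R`: the eigenvalues of
`exp (-β (H - μ N)) / Z`, listed along the same shared eigenbasis. -/
def GPState.Eigenbasis.equilibriumVector {ι : Type} [Fintype ι] [DecidableEq ι] {R : GPState ι}
    (B : R.Eigenbasis) (β μ : ℝ) : ι → ℝ :=
  fun i => ((B.Wᴴ * R.toGPSystem.equilibrium β μ * B.W) i i).re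

/-- `R` equimajorizes `S`: some stochastic matrix (nonnegative entries, columns that sum to one)
maps the state vector of `R` to that of `S`, and the state vector of the equilibrium state of `R`
to that of the equilibrium state of `S`. -/
def Equimajorizes {ι κ : Type} [Fintype ι] [DecidableEq ι] [Fintype κ] [DecidableEq κ]
    (β μ : ℝ) (R : GPState ι) (S : GPState κ) : Prop :=
  ∃ (B : R.Eigenbasis) (C : S.Eigenbasis) (M : Matrix κ ι ℝ),
    (∀ j i, 0 ≤ M j i) ∧ (∀ i, ∑ j, M j i = 1) ∧
      M *ᵥ B.stateVector = C.stateVector ∧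
      M *ᵥ B.equilibriumVector β μ = C.equilibriumVector β μ

end GrandPotential

end

/-! Necessity. An equilibrating operation is linear, positive and trace preserving. It also sends
the equilibrium state of the source exactly to that of the target: the product of the Boltzmann
operators of system and bath is the exponential of a combination of the total charges, so it
commutes with `U`, and the splitting carries it to the product of the Boltzmann operators of target
and discarded system. Read in joint eigenbases, each operation is therefore a stochastic matrix that
maps `g_R` to `g_S`. Stochastic matrices form a compact set, so a subsequence converges, and the
limit also maps `r` to `s`.

Sufficiency. The bath is a copy of the target together with a reservoir of quanta, with one kind of
quantum for each eigenvector of source and target, carrying the energy and number of that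
eigenvector. A reservoir level is a vector of occupation numbers from 0 to `L`, with degeneracy
about `K` divided by its Boltzmann weight. The joint level adds one quantum for the source
eigenvector `i` and one for the target eigenvector `j`. It determines both charges, so any
permutation that preserves it gives an admissible unitary.

Write `c` for the Boltzmann weights, `A` and `B` for their sums over source and target. In a joint
level of weight `w` away from the boundary of the box, about `K * c i * c j / w` states have the
pair `(i, j)`. The counts `M j i * K * c i * B / w` then have the right marginals: summing over `j`
uses that `M` is stochastic, summing over `i` uses that `M` preserves equilibrium. After rounding
down, some permutation realizes them (`exists_perm_level_card_ge`), and its transition probabilities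
are close to `M` because, for fixed `i`, all states in a level have equal weight. Growing `L` makes
the boundary of the box negligible and growing `K` the rounding (`exists_perm_transition_ge`);
swapping the source with the target copy turns the permutation into an operation
(`exists_operation_of_perm`). -/

noncomputable section

namespace GrandPotential

/-! ### Simultaneous diagonalization -/

/-- A commuting family of Hermitian matrices is diagonalized by a single unitary. -/
theorem exists_unitary_isDiag {n ι : Type} [Fintype ι] [DecidableEq ι] (T : n → Matrix ι ι ℂ)
    (hT : ∀ k, (T k).IsHermitian) (hC : ∀ k l, Commute (T k) (T l)) :
    ∃ W ∈ Matrix.unitaryGroup ι ℂ, ∀ k, (Wᴴ * T k * W).IsDiag := by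
  classical
  let E := EuclideanSpace ℂ ι
  let A : n → E →ₗ[ℂ] E := fun k => (T k).toEuclideanLin
  have hA : ∀ k, (A k).IsSymmetric := fun k => Matrix.isSymmetric_toEuclideanLin_iff.mpr (hT k)
  have hAC : Pairwise (Function.onFun Commute A) := by
    intro k l _
    change A k * A l = A l * A k
    ext v : 1
    refine (WithLp.ofLp_injective 2) ?_
    change T k *ᵥ T l *ᵥ v.ofLp = T l *ᵥ T k *ᵥ v.ofLp
    rw [Matrix.mulVec_mulVec, Matrix.mulVec_mulVec, (hC k l).eq]
  let V : (n → ℂ) → Submodule ℂ E := fun α => ⨅ j, Module.End.eigenspace (A j) (α j)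
  have hV : DirectSum.IsInternal V :=
    LinearMap.IsSymmetric.directSum_isInternal_of_pairwise_commute hA hAC
  have hO := LinearMap.IsSymmetric.orthogonalFamily_iInf_eigenspaces hA
  -- The joint eigenspaces are indexed by all tuples of complex numbers. Only finitely many are
  -- nonzero, and a subordinate orthonormal basis needs a finite index type.
  have hfin : Finite {α // V α ≠ ⊥} :=
    WellFoundedGT.finite_ne_bot_of_iSupIndep hV.submodule_iSupIndep
  have := Fintype.ofFinite {α // V α ≠ ⊥}
  have hV' := DirectSum.isInternal_ne_bot_iff.mpr hV
  have hO' : OrthogonalFamily ℂ (fun i : {α // V α ≠ ⊥} => V i) fun i => (V i).subtypeₗᵢ :=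
    hO.comp Subtype.val_injective
  have hn : Module.finrank ℂ E = Fintype.card ι := finrank_euclideanSpace
  let b0 := hV'.subordinateOrthonormalBasis hn hO'
  let b : OrthonormalBasis ι ℂ E := b0.reindex (Fintype.equivFin ι).symm
  have hb : ∀ i k, ∃ c : ℂ, A k (b i) = c • b i := by
    intro i k
    have h := hV'.subordinateOrthonormalBasis_subordinate hn (Fintype.equivFin ι i) hO'
    have h2 := (Submodule.mem_iInf _).mp h k
    rw [Module.End.mem_eigenspace_iff] at h2
    exact ⟨_, by simpa [b] using h2⟩
  refine ⟨(EuclideanSpace.basisFun ι ℂ).toBasis.toMatrix b,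
    OrthonormalBasis.toMatrix_orthonormalBasis_mem_unitary _ _, fun k i j hij => ?_⟩
  obtain ⟨c, hc⟩ := hb j k
  have h1 : inner ℂ (b i) (A k (b j)) = 0 := by
    rw [hc, inner_smul_right, b.orthonormal.2 hij, mul_zero]
  rw [← h1, Matrix.mul_assoc, Matrix.mul_apply]
  refine Finset.sum_congr rfl fun x _ => ?_
  exact mul_comm _ _

/-! ### Exponentials of transported matrices -/

section exp

attribute [local instance] Matrix.linftyOpNormedRing Matrix.linftyOpNormedAlgebra

/-- The exponential depends only on the topology, so the norm chosen locally for the power series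
does not enter the statement. -/
theorem map_matrix_exp {m n : Type} [Fintype m] [DecidableEq m] [Fintype n] [DecidableEq n]
    (φ : Matrix n n ℂ →+* Matrix m m ℂ) (hφ : Continuous φ) (A : Matrix n n ℂ) :
    φ (NormedSpace.exp A) = NormedSpace.exp (φ A) :=
  NormedSpace.map_exp φ hφ A

end exp

/-- Conjugation by `S` is a continuous ring homomorphism. `S` joins two index types because the
splitting of the composite does. -/
theorem exp_conj_rect {m n : Type} [Fintype m] [DecidableEq m] [Fintype n] [DecidableEq n]
    (S : Matrix m n ℂ) (h1 : Sᴴ * S = 1) (h2 : S * Sᴴ = 1) (A : Matrix n n ℂ) :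
    NormedSpace.exp (S * A * Sᴴ) = S * NormedSpace.exp A * Sᴴ := by
  let φ : Matrix n n ℂ →+* Matrix m m ℂ :=
    { toFun := fun A => S * A * Sᴴ
      map_one' := by simp [h2]
      map_mul' := fun A B => by
        calc S * (A * B) * Sᴴ = S * A * (1 : Matrix n n ℂ) * B * Sᴴ := by
              simp [Matrix.mul_assoc]
          _ = S * A * Sᴴ * (S * B * Sᴴ) := by rw [← h1]; simp only [Matrix.mul_assoc]
      map_zero' := by simp
      map_add' := fun A B => by simp [Matrix.mul_add, Matrix.add_mul] }
  exact (map_matrix_exp φ (by change Continuous fun A : Matrix n n ℂ => S * A * Sᴴ; fun_prop) A).symm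

theorem exp_kronecker_one {m n : Type} [Fintype m] [DecidableEq m] [Fintype n] [DecidableEq n]
    (A : Matrix n n ℂ) :
    NormedSpace.exp (A ⊗ₖ (1 : Matrix m m ℂ)) = NormedSpace.exp A ⊗ₖ (1 : Matrix m m ℂ) := by
  let φ : Matrix n n ℂ →+* Matrix (n × m) (n × m) ℂ :=
    { toFun := fun A => A ⊗ₖ (1 : Matrix m m ℂ)
      map_one' := by simp
      map_mul' := fun A B => by rw [← Matrix.mul_kronecker_mul, Matrix.one_mul]
      map_zero' := by simp
      map_add' := fun A B => Matrix.add_kronecker _ _ _ }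
  refine (map_matrix_exp φ ?_ A).symm
  exact continuous_matrix fun i j => by
    change Continuous fun A : Matrix n n ℂ => A i.1 j.1 * (1 : Matrix m m ℂ) i.2 j.2
    fun_prop

theorem exp_one_kronecker {m n : Type} [Fintype m] [DecidableEq m] [Fintype n] [DecidableEq n]
    (A : Matrix n n ℂ) :
    NormedSpace.exp ((1 : Matrix m m ℂ) ⊗ₖ A) = (1 : Matrix m m ℂ) ⊗ₖ NormedSpace.exp A := by
  let φ : Matrix n n ℂ →+* Matrix (m × n) (m × n) ℂ :=
    { toFun := fun A => (1 : Matrix m m ℂ) ⊗ₖ A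
      map_one' := by simp
      map_mul' := fun A B => by rw [← Matrix.mul_kronecker_mul, Matrix.one_mul]
      map_zero' := by simp
      map_add' := fun A B => Matrix.kronecker_add _ _ _ }
  refine (map_matrix_exp φ ?_ A).symm
  exact continuous_matrix fun i j => by
    change Continuous fun A : Matrix n n ℂ => (1 : Matrix m m ℂ) i.1 j.1 * A i.2 j.2
    fun_prop

theorem exp_total {m n : Type} [Fintype m] [DecidableEq m] [Fintype n] [DecidableEq n]
    (A : Matrix m m ℂ) (B : Matrix n n ℂ) :
    NormedSpace.exp (total A B) = NormedSpace.exp A ⊗ₖ NormedSpace.exp B := by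
  rw [total, Matrix.exp_add_of_commute, exp_kronecker_one, exp_one_kronecker,
    ← Matrix.mul_kronecker_mul, Matrix.mul_one, Matrix.one_mul]
  change _ * _ = _ * _
  rw [← Matrix.mul_kronecker_mul, ← Matrix.mul_kronecker_mul]
  simp

theorem total_combination {m n : Type} [DecidableEq m] [DecidableEq n] (a b : ℂ)
    (H N : Matrix m m ℂ) (H' N' : Matrix n n ℂ) :
    total (a • (H - b • N)) (a • (H' - b • N')) = a • (total H H' - b • total N N') := by
  ext i j
  simp [total]
  ring

/-! ### Equilibrium states -/

section equilibrium

variable {ι : Type} [Fintype ι] [DecidableEq ι]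

/-- The Boltzmann weights of a system with eigenvalues `h`, `n` of `H`, `N`. -/
def weight (β μ : ℝ) (h n : ℝ) : ℝ := Real.exp (-β * (h - μ * n))

theorem weight_pos (β μ h n : ℝ) : 0 < weight β μ h n := Real.exp_pos _

theorem weight_add (β μ h h' n n' : ℝ) :
    weight β μ (h + h') (n + n') = weight β μ h n * weight β μ h' n' := by
  rw [weight, weight, weight, ← Real.exp_add]; ring_nf

/-- The real diagonal of a matrix in the basis given by the columns of `W`. -/
def diagIn {m : Type} [Fintype m] (W : Matrix m ι ℂ) (A : Matrix m m ℂ) : ι → ℝ :=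
  fun i => ((Wᴴ * A * W) i i).re

/-- The matrix with eigenvalues `d` along the columns of `W`. -/
def ofDiag {m : Type} (W : Matrix m ι ℂ) (d : ι → ℝ) : Matrix m m ℂ :=
  W * Matrix.diagonal (fun i => (d i : ℂ)) * Wᴴ

/-- Hermiticity makes the diagonal real, so nothing is lost in taking real parts. -/
theorem eq_ofDiag {W A : Matrix ι ι ℂ} (hW : W ∈ Matrix.unitaryGroup ι ℂ) (hA : A.IsHermitian)
    (hd : (Wᴴ * A * W).IsDiag) : A = ofDiag W (diagIn W A) := by
  have h1 : W * Wᴴ = 1 := Matrix.mem_unitaryGroup_iff.mp hW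
  have hH : (Wᴴ * A * W).IsHermitian := Matrix.isHermitian_conjTranspose_mul_mul W hA
  have h2 : Matrix.diagonal (fun i => (diagIn W A i : ℂ)) = Wᴴ * A * W := by
    rw [← hd.diagonal_diag]
    congr 1
    funext i
    exact Complex.conj_eq_iff_re.mp (by simpa using hH.apply i i)
  rw [ofDiag, h2]
  calc A = (W * Wᴴ) * A * (W * Wᴴ) := by simp [h1]
    _ = _ := by simp only [Matrix.mul_assoc]

theorem conj_ofDiag {W : Matrix ι ι ℂ} (hW : W ∈ Matrix.unitaryGroup ι ℂ) (d : ι → ℝ) :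
    Wᴴ * ofDiag W d * W = Matrix.diagonal (fun i => (d i : ℂ)) := by
  have h1 : Wᴴ * W = 1 := Matrix.mem_unitaryGroup_iff'.mp hW
  calc Wᴴ * ofDiag W d * W = (Wᴴ * W) * Matrix.diagonal (fun i => (d i : ℂ)) * (Wᴴ * W) := by
        simp only [ofDiag, Matrix.mul_assoc]
    _ = _ := by simp [h1]

theorem diagIn_ofDiag {W : Matrix ι ι ℂ} (hW : W ∈ Matrix.unitaryGroup ι ℂ) (d : ι → ℝ) :
    diagIn W (ofDiag W d) = d := by
  funext i
  simp [diagIn, conj_ofDiag hW]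

theorem trace_ofDiag {W : Matrix ι ι ℂ} (hW : W ∈ Matrix.unitaryGroup ι ℂ) (d : ι → ℝ) :
    (ofDiag W d).trace = ((∑ i, d i : ℝ) : ℂ) := by
  have h1 : Wᴴ * W = 1 := Matrix.mem_unitaryGroup_iff'.mp hW
  rw [ofDiag, Matrix.trace_mul_comm, ← Matrix.mul_assoc, h1, Matrix.one_mul,
    Matrix.trace_diagonal]
  simp

theorem posSemidef_ofDiag {m : Type} [Finite m] (W : Matrix m ι ℂ) {d : ι → ℝ}
    (hd : ∀ i, 0 ≤ d i) : (ofDiag W d).PosSemidef :=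
  (Matrix.PosSemidef.diagonal fun i => by simpa using hd i).mul_mul_conjTranspose_same W

theorem exp_ofDiag {W : Matrix ι ι ℂ} (hW : W ∈ Matrix.unitaryGroup ι ℂ) (d : ι → ℝ) :
    NormedSpace.exp (ofDiag W d) = ofDiag W (fun i => Real.exp (d i)) := by
  rw [ofDiag, exp_conj_rect _ (Matrix.mem_unitaryGroup_iff'.mp hW)
    (Matrix.mem_unitaryGroup_iff.mp hW), Matrix.exp_diagonal, ofDiag]
  congr 3
  funext i
  simp [Pi.coe_exp, ← Complex.exp_eq_exp_ℂ]

theorem ofDiag_combination {m : Type} (W : Matrix m ι ℂ) (a b : ℝ) (d e : ι → ℝ) :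
    (a : ℂ) • (ofDiag W d - (b : ℂ) • ofDiag W e) = ofDiag W (fun i => a * (d i - b * e i)) := by
  have : Matrix.diagonal (fun i => ((a * (d i - b * e i) : ℝ) : ℂ)) =
      (a : ℂ) • (Matrix.diagonal (fun i => (d i : ℂ)) -
        (b : ℂ) • Matrix.diagonal (fun i => (e i : ℂ))) := by
    ext i j
    by_cases h : i = j <;> simp [h]
  conv_rhs => rw [ofDiag, this]
  simp [ofDiag, Matrix.mul_sub, Matrix.sub_mul]

theorem smul_ofDiag {m : Type} (W : Matrix m ι ℂ) (a : ℝ) (d : ι → ℝ) :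
    (a : ℂ) • ofDiag W d = ofDiag W (fun i => a * d i) := by
  have : Matrix.diagonal (fun i => ((a * d i : ℝ) : ℂ)) =
      (a : ℂ) • Matrix.diagonal (fun i => (d i : ℂ)) := by
    ext i j
    by_cases h : i = j <;> simp [h]
  rw [ofDiag, ofDiag, this]
  simp

theorem GPSystem.boltzmann_eq_ofDiag (X : GPSystem ι) (β μ : ℝ) {W : Matrix ι ι ℂ}
    (hW : W ∈ Matrix.unitaryGroup ι ℂ) {h n : ι → ℝ} (hH : X.H = ofDiag W h)
    (hN : X.N = ofDiag W n) :
    X.boltzmann β μ = ofDiag W (fun i => weight β μ (h i) (n i)) := by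
  rw [GPSystem.boltzmann, hH, hN, ← Complex.ofReal_neg, ofDiag_combination, exp_ofDiag hW]
  rfl

theorem GPSystem.equilibrium_eq_ofDiag (X : GPSystem ι) (β μ : ℝ) {W : Matrix ι ι ℂ}
    (hW : W ∈ Matrix.unitaryGroup ι ℂ) {h n : ι → ℝ} (hH : X.H = ofDiag W h)
    (hN : X.N = ofDiag W n) :
    X.equilibrium β μ =
      ofDiag W (fun i => (∑ k, weight β μ (h k) (n k))⁻¹ * weight β μ (h i) (n i)) := by
  rw [GPSystem.equilibrium, X.boltzmann_eq_ofDiag β μ hW hH hN, trace_ofDiag hW,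
    ← Complex.ofReal_inv, smul_ofDiag]

theorem GPSystem.exists_ofDiag (X : GPSystem ι) : ∃ W ∈ Matrix.unitaryGroup ι ℂ,
    ∃ h n : ι → ℝ, X.H = ofDiag W h ∧ X.N = ofDiag W n := by
  obtain ⟨W, hW, hd⟩ := exists_unitary_isDiag (fun b : Bool => if b then X.H else X.N)
    (by intro b; cases b <;> simp [X.H_hermitian, X.N_hermitian])
    (by intro b c; cases b <;> cases c <;> simp [X.commute_H_N, X.commute_H_N.symm])
  exact ⟨W, hW, _, _, eq_ofDiag hW X.H_hermitian (by simpa using hd true),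
    eq_ofDiag hW X.N_hermitian (by simpa using hd false)⟩

theorem GPSystem.equilibrium_posSemidef (X : GPSystem ι) (β μ : ℝ) :
    (X.equilibrium β μ).PosSemidef := by
  obtain ⟨W, hW, h, n, hH, hN⟩ := X.exists_ofDiag
  rw [X.equilibrium_eq_ofDiag β μ hW hH hN]
  exact posSemidef_ofDiag W fun i => mul_nonneg
    (inv_nonneg.mpr (Finset.sum_nonneg fun k _ => (weight_pos _ _ _ _).le)) (weight_pos _ _ _ _).le

theorem GPSystem.trace_boltzmann_ne_zero [Nonempty ι] (X : GPSystem ι) (β μ : ℝ) :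
    (X.boltzmann β μ).trace ≠ 0 := by
  obtain ⟨W, hW, h, n, hH, hN⟩ := X.exists_ofDiag
  rw [X.boltzmann_eq_ofDiag β μ hW hH hN, trace_ofDiag hW]
  exact_mod_cast (Finset.sum_pos (fun k _ => weight_pos β μ (h k) (n k))
    Finset.univ_nonempty).ne'

theorem GPSystem.trace_equilibrium [Nonempty ι] (X : GPSystem ι) (β μ : ℝ) :
    (X.equilibrium β μ).trace = 1 := by
  rw [GPSystem.equilibrium, Matrix.trace_smul, smul_eq_mul,
    inv_mul_cancel₀ (X.trace_boltzmann_ne_zero β μ)]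

theorem GPState.nonempty (R : GPState ι) : Nonempty ι := by
  by_contra h
  have := not_nonempty_iff.mp h
  have h1 := R.ρ_trace
  simp [Matrix.trace] at h1

theorem GPState.nonempty_eigenbasis (R : GPState ι) : Nonempty R.Eigenbasis := by
  obtain ⟨W, hW, hd⟩ := exists_unitary_isDiag ![R.ρ, R.H, R.N]
    (by intro k; fin_cases k <;> simp [R.H_hermitian, R.N_hermitian, R.ρ_posSemidef.isHermitian])
    (by
      intro k l
      fin_cases k <;> fin_cases l <;> simp [R.commute_H_N, R.commute_H_N.symm, R.commute_ρ_H,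
        R.commute_ρ_H.symm, R.commute_ρ_N, R.commute_ρ_N.symm])
  exact ⟨⟨W, hW, by simpa using hd 0, by simpa using hd 1, by simpa using hd 2⟩⟩

end equilibrium

/-! ### Partial trace -/

section traceOut

variable {κ α : Type} [Fintype α]

theorem traceOut_eq_sum (X : Matrix (κ × α) (κ × α) ℂ) :
    traceOut X = ∑ a, X.submatrix (fun j => (j, a)) (fun j => (j, a)) := by
  ext i j
  simp [traceOut, Matrix.sum_apply]

theorem traceOut_posSemidef [Finite κ] {X : Matrix (κ × α) (κ × α) ℂ} (hX : X.PosSemidef) :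
    (traceOut X).PosSemidef := by
  rw [traceOut_eq_sum]
  exact Matrix.posSemidef_sum _ fun a _ => hX.submatrix _

theorem trace_traceOut [Fintype κ] (X : Matrix (κ × α) (κ × α) ℂ) : (traceOut X).trace = X.trace := by
  simp [traceOut, Matrix.trace, Fintype.sum_prod_type]

theorem traceOut_kronecker (A : Matrix κ κ ℂ) (B : Matrix α α ℂ) :
    traceOut (A ⊗ₖ B) = B.trace • A := by
  ext i j
  simp [traceOut, Matrix.trace, Finset.mul_sum, mul_comm]

end traceOut

/-! ### The action of an equilibrating operation -/

namespace EquilibratingOperation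

variable {ι κ : Type} [Fintype ι] [DecidableEq ι] [Fintype κ] [DecidableEq κ]
  {X : GPSystem ι} {Y : GPSystem κ} (O : EquilibratingOperation X Y) (β μ : ℝ)

theorem map_posSemidef {ρ : Matrix ι ι ℂ} (hρ : ρ.PosSemidef) : (O.map β μ ρ).PosSemidef :=
  traceOut_posSemidef (((hρ.kronecker (O.bath.equilibrium_posSemidef β μ)).mul_mul_conjTranspose_same
    O.U).mul_mul_conjTranspose_same O.split)

theorem trace_map (ρ : Matrix ι ι ℂ) : (O.map β μ ρ).trace = ρ.trace := by
  have hU : O.Uᴴ * O.U = 1 := Matrix.mem_unitaryGroup_iff'.mp O.U_unitary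
  rw [map, trace_traceOut, Matrix.trace_mul_comm, ← Matrix.mul_assoc, O.split_isometry,
    Matrix.one_mul, Matrix.trace_mul_comm, ← Matrix.mul_assoc, hU, Matrix.one_mul,
    Matrix.trace_kronecker, GPSystem.trace_equilibrium, mul_one]

theorem map_add (ρ σ : Matrix ι ι ℂ) : O.map β μ (ρ + σ) = O.map β μ ρ + O.map β μ σ := by
  simp only [map, Matrix.add_kronecker, Matrix.mul_add, Matrix.add_mul]
  ext i j
  simp [traceOut, Finset.sum_add_distrib]

theorem map_smul (c : ℂ) (ρ : Matrix ι ι ℂ) : O.map β μ (c • ρ) = c • O.map β μ ρ := by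
  simp only [map, Matrix.smul_kronecker, Matrix.mul_smul, Matrix.smul_mul]
  ext i j
  simp [traceOut, Finset.mul_sum]

/-- The operation as a linear map. -/
def mapLinear : Matrix ι ι ℂ →ₗ[ℂ] Matrix κ κ ℂ where
  toFun := O.map β μ
  map_add' := O.map_add β μ
  map_smul' := O.map_smul β μ

/-- Both sides are exponentials of the same combination of total charges, which `U` fixes and the
splitting carries over. -/
theorem split_boltzmann :
    O.split * (O.U * (X.boltzmann β μ ⊗ₖ O.bath.boltzmann β μ) * O.Uᴴ) * O.splitᴴ =
      Y.boltzmann β μ ⊗ₖ O.discarded.boltzmann β μ := by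
  have hU : O.U * O.Uᴴ = 1 := Matrix.mem_unitaryGroup_iff.mp O.U_unitary
  have hU' : O.Uᴴ * O.U = 1 := Matrix.mem_unitaryGroup_iff'.mp O.U_unitary
  simp only [GPSystem.boltzmann, ← exp_total, total_combination]
  rw [← exp_conj_rect _ hU' hU, ← exp_conj_rect _ O.split_isometry O.split_coisometry]
  have h1 : Commute O.U (-(β : ℂ) • (total X.H O.bath.H - (μ : ℂ) • total X.N O.bath.N)) :=
    (O.U_commute_H.sub_right (O.U_commute_N.smul_right _)).smul_right _
  rw [h1.eq, Matrix.mul_assoc (-(β : ℂ) • _), hU, Matrix.mul_one]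
  simp only [Matrix.mul_smul, Matrix.smul_mul, Matrix.mul_sub, Matrix.sub_mul, O.split_H,
    O.split_N]

/-- `split_boltzmann` gives the result up to a scalar, and trace preservation determines the scalar
without comparing partition functions. -/
theorem map_equilibrium [Nonempty ι] :
    O.map β μ (X.equilibrium β μ) = Y.equilibrium β μ := by
  have h1 : O.map β μ (X.equilibrium β μ) =
      ((X.boltzmann β μ).trace⁻¹ * (O.bath.boltzmann β μ).trace⁻¹ *
        (O.discarded.boltzmann β μ).trace) • Y.boltzmann β μ := by
    rw [GPSystem.equilibrium, map_smul, map, GPSystem.equilibrium, Matrix.kronecker_smul,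
      Matrix.mul_smul, Matrix.smul_mul, Matrix.mul_smul, Matrix.smul_mul, O.split_boltzmann,
      ← Matrix.smul_kronecker, traceOut_kronecker, smul_smul, smul_smul]
    congr 1
    ring
  have h2 : (O.map β μ (X.equilibrium β μ)).trace = 1 := by
    rw [trace_map, GPSystem.trace_equilibrium]
  rw [h1] at h2 ⊢
  rw [Matrix.trace_smul, smul_eq_mul] at h2
  rw [GPSystem.equilibrium, eq_inv_of_mul_eq_one_left h2]

end EquilibratingOperation

/-! ### Conversion implies equimajorization -/

section necessity

variable {ι κ : Type} [Fintype ι] [DecidableEq ι] [Fintype κ] [DecidableEq κ]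

theorem sum_diagIn {V : Matrix κ κ ℂ} (hV : V ∈ Matrix.unitaryGroup κ ℂ) (A : Matrix κ κ ℂ) :
    ∑ j, diagIn V A j = A.trace.re := by
  have h1 : V * Vᴴ = 1 := Matrix.mem_unitaryGroup_iff.mp hV
  have h2 : (Vᴴ * A * V).trace = A.trace := by
    rw [Matrix.trace_mul_comm, ← Matrix.mul_assoc, h1, Matrix.one_mul]
  rw [← h2, Matrix.trace, Complex.re_sum]
  rfl

theorem diagIn_nonneg {m : Type} [Fintype m] (V : Matrix m m ℂ) {A : Matrix m m ℂ}
    (hA : A.PosSemidef) (j : m) :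
    0 ≤ diagIn V A j :=
  (Complex.le_def.mp (hA.conjTranspose_mul_mul_same V).diag_nonneg).1

theorem ofDiag_eq_sum (W : Matrix ι ι ℂ) (d : ι → ℝ) :
    ofDiag W d = ∑ i, (d i : ℂ) • ofDiag W (Pi.single i 1) := by
  have : Matrix.diagonal (fun i => (d i : ℂ)) =
      ∑ i, (d i : ℂ) • Matrix.diagonal (fun k => ((Pi.single i 1 : ι → ℝ) k : ℂ)) := by
    ext a b
    by_cases h : a = b
    · subst h
      simp [Matrix.sum_apply, Pi.single_apply, apply_ite Complex.ofReal]
    · simp [Matrix.sum_apply, h]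
  rw [ofDiag, this, Matrix.mul_sum, Matrix.sum_mul]
  simp [ofDiag]

theorem continuous_diagIn {m : Type} [Fintype m] (V : Matrix m m ℂ) (j : m) :
    Continuous fun A : Matrix m m ℂ => diagIn V A j := by
  have : Continuous fun A : Matrix m m ℂ => Vᴴ * A * V := by fun_prop
  exact Complex.continuous_re.comp (this.matrix_elem j j)

/-- The transition matrix that an operation induces between two eigenbases. -/
def EquilibratingOperation.transition {X : GPSystem ι} {Y : GPSystem κ}
    (O : EquilibratingOperation X Y) (β μ : ℝ) (W : Matrix ι ι ℂ) (V : Matrix κ κ ℂ) :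
    Matrix κ ι ℝ :=
  Matrix.of fun j i => diagIn V (O.map β μ (ofDiag W (Pi.single i 1))) j

/-- This is linearity in the input. The output need not be diagonal in `V`; only its diagonal is
recorded. -/
theorem EquilibratingOperation.transition_mulVec {X : GPSystem ι} {Y : GPSystem κ}
    (O : EquilibratingOperation X Y) (β μ : ℝ) (W : Matrix ι ι ℂ) (V : Matrix κ κ ℂ)
    (d : ι → ℝ) : O.transition β μ W V *ᵥ d = diagIn V (O.map β μ (ofDiag W d)) := by
  have h : O.map β μ (ofDiag W d) =
      ∑ i, (d i : ℂ) • O.map β μ (ofDiag W (Pi.single i 1)) := by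
    rw [ofDiag_eq_sum]
    change O.mapLinear β μ _ = _
    rw [map_sum]
    exact Finset.sum_congr rfl fun i _ => O.map_smul β μ _ _
  funext j
  rw [h, diagIn, Matrix.mul_sum, Matrix.sum_mul, Matrix.sum_apply, Complex.re_sum]
  refine Finset.sum_congr rfl fun i _ => ?_
  simp [transition, diagIn, mul_comm]

theorem stochastic_le_one {m n : Type} [Fintype m] {M : Matrix m n ℝ} (h0 : ∀ j i, 0 ≤ M j i)
    (h1 : ∀ i, ∑ j, M j i = 1) (j : m) (i : n) : M j i ≤ 1 := by
  rw [← h1 i]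
  exact Finset.single_le_sum (f := fun j => M j i) (fun k _ => h0 k i) (Finset.mem_univ j)

theorem GPState.Eigenbasis.eq_ofDiag_ρ {R : GPState ι} (B : R.Eigenbasis) :
    R.ρ = ofDiag B.W B.stateVector :=
  eq_ofDiag B.W_unitary R.ρ_posSemidef.isHermitian B.ρ_isDiag

theorem GPState.Eigenbasis.eq_ofDiag_H {R : GPState ι} (B : R.Eigenbasis) :
    R.H = ofDiag B.W (diagIn B.W R.H) :=
  eq_ofDiag B.W_unitary R.H_hermitian B.H_isDiag

theorem GPState.Eigenbasis.eq_ofDiag_N {R : GPState ι} (B : R.Eigenbasis) :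
    R.N = ofDiag B.W (diagIn B.W R.N) :=
  eq_ofDiag B.W_unitary R.N_hermitian B.N_isDiag

theorem GPState.Eigenbasis.eq_ofDiag_equilibrium {R : GPState ι} (B : R.Eigenbasis) (β μ : ℝ) :
    R.equilibrium β μ = ofDiag B.W (B.equilibriumVector β μ) := by
  have h := R.toGPSystem.equilibrium_eq_ofDiag β μ B.W_unitary B.eq_ofDiag_H B.eq_ofDiag_N
  refine eq_ofDiag B.W_unitary (R.equilibrium_posSemidef β μ).isHermitian ?_
  rw [h, conj_ofDiag B.W_unitary]
  exact Matrix.isDiag_diagonal _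

theorem GPState.Eigenbasis.equilibriumVector_eq {R : GPState ι} (B : R.Eigenbasis) (β μ : ℝ)
    (i : ι) : B.equilibriumVector β μ i =
      (∑ k, weight β μ (diagIn B.W R.H k) (diagIn B.W R.N k))⁻¹ *
        weight β μ (diagIn B.W R.H i) (diagIn B.W R.N i) := by
  have h := R.toGPSystem.equilibrium_eq_ofDiag β μ B.W_unitary B.eq_ofDiag_H B.eq_ofDiag_N
  change diagIn B.W (R.equilibrium β μ) i = _
  rw [h, diagIn_ofDiag B.W_unitary]

theorem Converts.equimajorizes {β μ : ℝ} {R : GPState ι} {S : GPState κ}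
    (h : Converts β μ R S) : Equimajorizes β μ R S := by
  obtain ⟨O, hO⟩ := h
  obtain ⟨B⟩ := R.nonempty_eigenbasis
  obtain ⟨C⟩ := S.nonempty_eigenbasis
  have := R.nonempty
  let M : ℕ → Matrix κ ι ℝ := fun n => (O n).transition β μ B.W C.W
  have hpos : ∀ i k, 0 ≤ (Pi.single i 1 : ι → ℝ) k := fun i k => by
    by_cases hk : k = i <;> simp [hk]
  have hM0 : ∀ n j i, 0 ≤ M n j i := fun n j i =>
    diagIn_nonneg _ ((O n).map_posSemidef β μ (posSemidef_ofDiag _ (hpos i))) j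
  have hM1 : ∀ n i, ∑ j, M n j i = 1 := fun n i => by
    have := sum_diagIn C.W_unitary ((O n).map β μ (ofDiag B.W (Pi.single i 1)))
    rw [EquilibratingOperation.trace_map, trace_ofDiag B.W_unitary] at this
    exact this.trans (by simp)
  let K : Set (κ → ι → ℝ) := Set.pi Set.univ fun _ => Set.pi Set.univ fun _ => Set.Icc 0 1
  have hK : IsCompact K := isCompact_univ_pi fun _ => isCompact_univ_pi fun _ => isCompact_Icc
  have hMK : ∀ n, M n ∈ K := fun n j _ i _ =>
    ⟨hM0 n j i, stochastic_le_one (hM0 n) (hM1 n) j i⟩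
  -- The operations themselves need not converge, but their transition matrices lie in a compact
  -- cube.
  obtain ⟨L', -, φ, hφ, hL⟩ := 
    @IsCompact.tendsto_subseq (κ → ι → ℝ) _ _ K M hK hMK
  let L : Matrix κ ι ℝ := L'
  have hLe : ∀ j i, Filter.Tendsto (fun n => M (φ n) j i) Filter.atTop (nhds (L j i)) :=
    fun j i => (tendsto_pi_nhds.mp (tendsto_pi_nhds.mp hL j) i)
  have hLv : ∀ (d : ι → ℝ) j, Filter.Tendsto (fun n => (M (φ n) *ᵥ d) j) Filter.atTop
      (nhds ((L *ᵥ d) j)) := fun d j =>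
    tendsto_finsetSum _ fun i _ => (hLe j i).mul_const _
  refine ⟨B, C, L, fun j i => ge_of_tendsto' (hLe j i) fun n => hM0 _ _ _, fun i => ?_, ?_, ?_⟩
  · refine tendsto_nhds_unique (tendsto_finsetSum _ fun j _ => hLe j i) ?_
    simp [hM1]
  · funext j
    refine tendsto_nhds_unique (hLv _ j) ?_
    have h1 : ∀ n, (M (φ n) *ᵥ B.stateVector) j = diagIn C.W ((O (φ n)).map β μ R.ρ) j := by
      intro n
      rw [EquilibratingOperation.transition_mulVec, ← B.eq_ofDiag_ρ]
    simp only [h1]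
    exact ((continuous_diagIn C.W j).tendsto S.ρ).comp (hO.comp hφ.tendsto_atTop)
  · funext j
    refine tendsto_nhds_unique (hLv _ j) ?_
    -- Equilibrium is preserved exactly at every stage, so this sequence is constant.
    have h1 : ∀ n, (M (φ n) *ᵥ B.equilibriumVector β μ) j = C.equilibriumVector β μ j := by
      intro n
      rw [EquilibratingOperation.transition_mulVec, ← B.eq_ofDiag_equilibrium,
        EquilibratingOperation.map_equilibrium]
      rfl
    simp [h1]

end necessity

/-! ### Operations that permute eigenvectors -/

section permutation

/-- The matrix of the bijection `e` between two index types. -/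
def permMat {m n : Type} [DecidableEq n] (e : n ≃ m) : Matrix m n ℂ :=
  (1 : Matrix n n ℂ).submatrix e.symm id

/-- The unitary that takes the column `x` of `W` to the column `e x` of `V`. -/
def transport {m n : Type} [Fintype m] [DecidableEq n] [Fintype n]
    (V : Matrix m m ℂ) (e : n ≃ m) (W : Matrix n n ℂ) : Matrix m n ℂ :=
  V * permMat e * Wᴴ

variable {m n : Type} [Fintype n] [DecidableEq n]

theorem permMat_mul_conjTranspose [DecidableEq m] (e : n ≃ m) : permMat e * (permMat e)ᴴ = 1 := by
  rw [permMat, Matrix.conjTranspose_submatrix,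
    ← Matrix.submatrix_mul _ _ _ id _ Function.bijective_id]
  simp

theorem conjTranspose_mul_permMat [Fintype m] (e : n ≃ m) : (permMat e)ᴴ * permMat e = 1 := by
  rw [permMat, Matrix.conjTranspose_submatrix,
    ← Matrix.submatrix_mul _ _ _ e.symm _ e.symm.bijective]
  simp

theorem permMat_mul_diagonal_mul [DecidableEq m] (e : n ≃ m) (d : n → ℂ) :
    permMat e * Matrix.diagonal d * (permMat e)ᴴ = Matrix.diagonal (d ∘ e.symm) := by
  have h : permMat e * Matrix.diagonal d = (Matrix.diagonal d).submatrix e.symm id := by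
    ext x y
    simp only [permMat, Matrix.mul_diagonal, Matrix.submatrix_apply, id, Matrix.one_apply,
      Matrix.diagonal_apply]
    split_ifs with hxy
    · rw [hxy, one_mul]
    · rw [zero_mul]
  rw [h, permMat, Matrix.conjTranspose_submatrix,
    ← Matrix.submatrix_mul _ _ _ id _ Function.bijective_id]
  simp

theorem ofDiag_add (W : Matrix m n ℂ) (d e : n → ℝ) :
    ofDiag W d + ofDiag W e = ofDiag W (fun i => d i + e i) := by
  simp only [ofDiag, ← Matrix.add_mul, ← Matrix.mul_add, Matrix.diagonal_add, Complex.ofReal_add]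

theorem ofDiag_apply (W : Matrix m n ℂ) (d : n → ℝ) (i j : m) :
    ofDiag W d i j = ∑ k, W i k * d k * star (W j k) := by
  rw [ofDiag, Matrix.mul_apply]
  simp [Matrix.mul_diagonal]

variable [Fintype m] [DecidableEq m] {V : Matrix m m ℂ} {W : Matrix n n ℂ}

theorem transport_mul_conjTranspose (hV : V ∈ Matrix.unitaryGroup m ℂ)
    (hW : W ∈ Matrix.unitaryGroup n ℂ) (e : n ≃ m) :
    transport V e W * (transport V e W)ᴴ = 1 := by
  have h1 : V * Vᴴ = 1 := Matrix.mem_unitaryGroup_iff.mp hV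
  have h2 : Wᴴ * W = 1 := Matrix.mem_unitaryGroup_iff'.mp hW
  calc transport V e W * (transport V e W)ᴴ = V * (permMat e * (Wᴴ * W) * (permMat e)ᴴ) * Vᴴ := by
        simp only [transport, Matrix.conjTranspose_mul, Matrix.conjTranspose_conjTranspose,
          Matrix.mul_assoc]
    _ = 1 := by rw [h2, Matrix.mul_one, permMat_mul_conjTranspose, Matrix.mul_one, h1]

theorem conjTranspose_mul_transport (hV : V ∈ Matrix.unitaryGroup m ℂ)
    (hW : W ∈ Matrix.unitaryGroup n ℂ) (e : n ≃ m) :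
    (transport V e W)ᴴ * transport V e W = 1 := by
  have h1 : Vᴴ * V = 1 := Matrix.mem_unitaryGroup_iff'.mp hV
  have h2 : W * Wᴴ = 1 := Matrix.mem_unitaryGroup_iff.mp hW
  calc (transport V e W)ᴴ * transport V e W = W * ((permMat e)ᴴ * (Vᴴ * V) * permMat e) * Wᴴ := by
        simp only [transport, Matrix.conjTranspose_mul, Matrix.conjTranspose_conjTranspose,
          Matrix.mul_assoc]
    _ = 1 := by rw [h1, Matrix.mul_one, conjTranspose_mul_permMat, Matrix.mul_one, h2]

theorem transport_conj_ofDiag (hW : W ∈ Matrix.unitaryGroup n ℂ) (e : n ≃ m) (d : n → ℝ) :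
    transport V e W * ofDiag W d * (transport V e W)ᴴ = ofDiag V (d ∘ e.symm) := by
  have h2 : Wᴴ * W = 1 := Matrix.mem_unitaryGroup_iff'.mp hW
  calc transport V e W * ofDiag W d * (transport V e W)ᴴ =
      V * (permMat e * ((Wᴴ * W) * Matrix.diagonal (fun i => (d i : ℂ)) * (Wᴴ * W)) *
        (permMat e)ᴴ) * Vᴴ := by
        simp only [transport, ofDiag, Matrix.conjTranspose_mul, Matrix.conjTranspose_conjTranspose,
          Matrix.mul_assoc]
    _ = _ := by
      rw [h2, Matrix.mul_one, Matrix.one_mul, permMat_mul_diagonal_mul]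
      rfl

theorem kronecker_one_mem_unitaryGroup {b : Type} [Fintype b] [DecidableEq b]
    (hW : W ∈ Matrix.unitaryGroup n ℂ) :
    W ⊗ₖ (1 : Matrix b b ℂ) ∈ Matrix.unitaryGroup (n × b) ℂ := by
  rw [Matrix.mem_unitaryGroup_iff]
  have h : W * Wᴴ = 1 := Matrix.mem_unitaryGroup_iff.mp hW
  change _ * (W ⊗ₖ (1 : Matrix b b ℂ))ᴴ = 1
  rw [Matrix.conjTranspose_kronecker, ← Matrix.mul_kronecker_mul, h]
  simp

theorem ofDiag_kronecker_diagonal {b : Type} [Fintype b] [DecidableEq b] (W : Matrix n n ℂ)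
    (d : n → ℝ) (g : b → ℝ) :
    ofDiag W d ⊗ₖ ofDiag (1 : Matrix b b ℂ) g =
      ofDiag (W ⊗ₖ (1 : Matrix b b ℂ)) (fun p => d p.1 * g p.2) := by
  simp only [ofDiag, Matrix.mul_kronecker_mul, Matrix.diagonal_kronecker_diagonal,
    Matrix.conjTranspose_kronecker, Complex.ofReal_mul]

theorem ofDiag_one (hW : W ∈ Matrix.unitaryGroup n ℂ) : ofDiag W (fun _ => 1) = 1 := by
  have h : W * Wᴴ = 1 := Matrix.mem_unitaryGroup_iff.mp hW
  simp [ofDiag, h]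

theorem total_ofDiag {b : Type} [Fintype b] [DecidableEq b] (hW : W ∈ Matrix.unitaryGroup n ℂ)
    (d : n → ℝ) (g : b → ℝ) :
    total (ofDiag W d) (ofDiag (1 : Matrix b b ℂ) g) =
      ofDiag (W ⊗ₖ (1 : Matrix b b ℂ)) (fun p => d p.1 + g p.2) := by
  have h1 := ofDiag_kronecker_diagonal W d (fun _ : b => 1)
  have h2 := ofDiag_kronecker_diagonal W (fun _ => 1) g
  rw [ofDiag_one (one_mem _)] at h1
  rw [ofDiag_one hW] at h2
  rw [total, h1, h2, ofDiag_add]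
  simp

theorem traceOut_ofDiag {b : Type} [Fintype b] [DecidableEq b] (W : Matrix n n ℂ)
    (d : n × b → ℝ) :
    traceOut (ofDiag (W ⊗ₖ (1 : Matrix b b ℂ)) d) = ofDiag W (fun i => ∑ a, d (i, a)) := by
  ext i j
  simp only [traceOut, Matrix.of_apply, ofDiag_apply, Matrix.kronecker_apply,
    Fintype.sum_prod_type, Matrix.one_apply, Complex.ofReal_sum]
  rw [Finset.sum_comm]
  refine Finset.sum_congr rfl fun x _ => ?_
  simp [Finset.mul_sum, Finset.sum_mul]

/-- The system with joint eigenvalues `h`, `n` along the standard basis. -/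
def diagSystem (h : n → ℝ) (k : n → ℝ) : GPSystem n where
  H := ofDiag 1 h
  N := ofDiag 1 k
  H_hermitian := by
    simp only [ofDiag, Matrix.IsHermitian, Matrix.conjTranspose_one,
      Matrix.diagonal_conjTranspose, Matrix.one_mul, Matrix.mul_one]
    congr 1; funext i; simp
  N_hermitian := by
    simp only [ofDiag, Matrix.IsHermitian, Matrix.conjTranspose_one,
      Matrix.diagonal_conjTranspose, Matrix.one_mul, Matrix.mul_one]
    congr 1; funext i; simp
  commute_H_N := by
    simp only [ofDiag, Matrix.one_mul, Matrix.conjTranspose_one, Matrix.mul_one]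
    exact Matrix.commute_diagonal _ _

/-- Conjugation by the transport permutes the eigenvalues, and `d` is invariant under the
permutation. -/
theorem commute_transport (hW : W ∈ Matrix.unitaryGroup n ℂ) (e : Equiv.Perm n) {d : n → ℝ}
    (hd : ∀ x, d (e x) = d x) : Commute (transport W e W) (ofDiag W d) := by
  have h1 := conjTranspose_mul_transport hW hW e
  have h2 := transport_conj_ofDiag (V := W) hW e d
  have h3 : d ∘ e.symm = d := by
    funext x
    simpa using (hd (e.symm x)).symm
  rw [h3] at h2
  calc transport W e W * ofDiag W d =
      transport W e W * ofDiag W d * ((transport W e W)ᴴ * transport W e W) := by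
        rw [h1, Matrix.mul_one]
    _ = _ := by rw [← Matrix.mul_assoc, h2]

/-- Exchange of the system with the first factor of the bath. -/
def exchange (m n b : Type) : n × m × b ≃ m × n × b where
  toFun p := (p.2.1, p.1, p.2.2)
  invFun p := (p.2.1, p.1, p.2.2)
  left_inv _ := rfl
  right_inv _ := rfl

/-- A permutation of the joint eigenvectors of a system, a copy of the target system and a
reservoir, that conserves the charges, yields an equilibrating operation. -/
theorem exists_operation_of_perm {b : Type} [Fintype b] [DecidableEq b] [Nonempty b]
    [Nonempty m] (X : GPSystem n) (Y : GPSystem m) (β μ : ℝ)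
    (hW : W ∈ Matrix.unitaryGroup n ℂ) (hV : V ∈ Matrix.unitaryGroup m ℂ)
    {hX nX : n → ℝ} {hY nY : m → ℝ} (hXH : X.H = ofDiag W hX) (hXN : X.N = ofDiag W nX)
    (hYH : Y.H = ofDiag V hY) (hYN : Y.N = ofDiag V nY) (hb nb : b → ℝ)
    (π : Equiv.Perm (n × m × b))
    (hπH : ∀ p, hX (π p).1 + (hY (π p).2.1 + hb (π p).2.2) = hX p.1 + (hY p.2.1 + hb p.2.2))
    (hπN : ∀ p, nX (π p).1 + (nY (π p).2.1 + nb (π p).2.2) = nX p.1 + (nY p.2.1 + nb p.2.2)) :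
    ∃ O : EquilibratingOperation X Y, ∀ d : n → ℝ,
      O.map β μ (ofDiag W d) = ofDiag V (fun j => ∑ i, d i *
        ((∑ q : m × b, weight β μ (hY q.1 + hb q.2) (nY q.1 + nb q.2))⁻¹ *
          ∑ q : m × b with (π (i, q)).2.1 = j,
            weight β μ (hY q.1 + hb q.2) (nY q.1 + nb q.2))) := by
  have hW' : W ⊗ₖ (1 : Matrix (m × b) (m × b) ℂ) ∈ Matrix.unitaryGroup (n × m × b) ℂ :=
    kronecker_one_mem_unitaryGroup hW
  have hV' : V ⊗ₖ (1 : Matrix (n × b) (n × b) ℂ) ∈ Matrix.unitaryGroup (m × n × b) ℂ :=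
    kronecker_one_mem_unitaryGroup hV
  -- The bath contains a copy of the target. Afterwards this copy is kept, while the source and the
  -- reservoir are discarded, so the splitting is a mere exchange of factors.
  let bath : GPSystem (m × b) := diagSystem (fun q => hY q.1 + hb q.2) fun q => nY q.1 + nb q.2
  let O : EquilibratingOperation X Y :=
    { bathIdx := m × b
      bath := bath
      U := transport (W ⊗ₖ (1 : Matrix (m × b) (m × b) ℂ)) π (W ⊗ₖ (1 : Matrix (m × b) (m × b) ℂ))
      U_unitary := Matrix.mem_unitaryGroup_iff.mpr (transport_mul_conjTranspose hW' hW' π)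
      U_commute_H := by
        rw [hXH]
        simp only [bath, diagSystem]
        rw [total_ofDiag hW]
        exact commute_transport hW' π hπH
      U_commute_N := by
        rw [hXN]
        simp only [bath, diagSystem]
        rw [total_ofDiag hW]
        exact commute_transport hW' π hπN
      discardedIdx := n × b
      discarded := diagSystem (fun q => hX q.1 + hb q.2) fun q => nX q.1 + nb q.2
      split := transport (V ⊗ₖ (1 : Matrix (n × b) (n × b) ℂ)) (exchange m n b) (W ⊗ₖ (1 : Matrix (m × b) (m × b) ℂ))
      split_isometry := conjTranspose_mul_transport hV' hW' _
      split_coisometry := transport_mul_conjTranspose hV' hW' _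
      split_H := by
        rw [hXH, hYH]
        simp only [bath, diagSystem]
        rw [total_ofDiag hW, total_ofDiag hV, transport_conj_ofDiag hW']
        congr 1; funext p; simp [exchange]; ring
      split_N := by
        rw [hXN, hYN]
        simp only [bath, diagSystem]
        rw [total_ofDiag hW, total_ofDiag hV, transport_conj_ofDiag hW']
        congr 1; funext p; simp [exchange]; ring }
  refine ⟨O, fun d => ?_⟩
  have hγ : bath.equilibrium β μ = ofDiag 1 (fun q : m × b =>
      (∑ q : m × b, weight β μ (hY q.1 + hb q.2) (nY q.1 + nb q.2))⁻¹ *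
        weight β μ (hY q.1 + hb q.2) (nY q.1 + nb q.2)) :=
    bath.equilibrium_eq_ofDiag β μ (one_mem _) rfl rfl
  set γ : m × b → ℝ := fun q =>
      (∑ q : m × b, weight β μ (hY q.1 + hb q.2) (nY q.1 + nb q.2))⁻¹ *
        weight β μ (hY q.1 + hb q.2) (nY q.1 + nb q.2) with hγdef
  change traceOut (transport (V ⊗ₖ (1 : Matrix (n × b) (n × b) ℂ)) (exchange m n b) (W ⊗ₖ (1 : Matrix (m × b) (m × b) ℂ)) *
    (transport (W ⊗ₖ (1 : Matrix (m × b) (m × b) ℂ)) π (W ⊗ₖ (1 : Matrix (m × b) (m × b) ℂ)) * (ofDiag W d ⊗ₖ bath.equilibrium β μ) *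
      (transport (W ⊗ₖ (1 : Matrix (m × b) (m × b) ℂ)) π (W ⊗ₖ (1 : Matrix (m × b) (m × b) ℂ)))ᴴ) * (transport (V ⊗ₖ (1 : Matrix (n × b) (n × b) ℂ)) (exchange m n b) (W ⊗ₖ (1 : Matrix (m × b) (m × b) ℂ)))ᴴ) = _
  rw [hγ, ofDiag_kronecker_diagonal, transport_conj_ofDiag hW', transport_conj_ofDiag hW',
    traceOut_ofDiag]
  congr 1
  funext j
  -- `D` is the spectrum of the initial product state. The output at `j` collects it over the points
  -- whose image has target index `j`.
  let D : n × m × b → ℝ := fun p => d p.1 * γ p.2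
  calc ∑ a, D (π.symm ((exchange m n b).symm (j, a)))
      = ∑ p : m × n × b with p.1 = j, D (π.symm ((exchange m n b).symm p)) := by
        conv_rhs => rw [Finset.sum_filter, Fintype.sum_prod_type]
        refine ((Fintype.sum_eq_single j fun x hx => ?_).trans ?_).symm
        · simp [hx]
        · simp
    _ = ∑ p : n × m × b with (π p).2.1 = j, D p := by
        rw [Finset.sum_filter, Finset.sum_filter]
        refine (Fintype.sum_equiv (π.trans (exchange m n b)) _ _ fun p => ?_).symm
        simp [exchange]
    _ = _ := by
        rw [Finset.sum_filter, Fintype.sum_prod_type]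
        refine Finset.sum_congr rfl fun i _ => ?_
        rw [Finset.sum_filter, Finset.mul_sum, Finset.mul_sum]
        refine Finset.sum_congr rfl fun q _ => ?_
        split_ifs <;> simp [D, hγdef]

end permutation

/-! ### Permutations with prescribed transition counts -/

section counting

variable {P ι κ T : Type} [Fintype P] [Fintype ι] [Fintype κ] [DecidableEq ι] [DecidableEq κ]

/-- If the numbers `k j i` fit into the fibres of `f` and of `g`, then some permutation takes at
least `k j i` points of `f ⁻¹ i` to `g ⁻¹ j`. -/
theorem exists_perm_card_ge (f : P → ι) (g : P → κ) (k : κ → ι → ℕ)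
    (hf : ∀ i, ∑ j, k j i ≤ Fintype.card {p // f p = i})
    (hg : ∀ j, ∑ i, k j i ≤ Fintype.card {p // g p = j}) :
    ∃ π : Equiv.Perm P, ∀ j i, k j i ≤ Fintype.card {p // f p = i ∧ g (π p) = j} := by
  have hφ : ∀ i, Nonempty ((Σ j, Fin (k j i)) ↪ {p // f p = i}) := fun i =>
    Function.Embedding.nonempty_of_card_le (by simpa using hf i)
  have hψ : ∀ j, Nonempty ((Σ i, Fin (k j i)) ↪ {p // g p = j}) := fun j =>
    Function.Embedding.nonempty_of_card_le (by simpa using hg j)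
  let φ := fun i => (hφ i).some
  let ψ := fun j => (hψ j).some
  -- Tokens labelled by `(j, i)` are placed injectively by `F` in the fibre of `f` over `i` and by
  -- `G` in the fibre of `g` over `j`. A permutation extending `F x ↦ G x` has the required counts.
  let F : (Σ q : κ × ι, Fin (k q.1 q.2)) → P := fun x => φ x.1.2 ⟨x.1.1, x.2⟩
  let G : (Σ q : κ × ι, Fin (k q.1 q.2)) → P := fun x => ψ x.1.1 ⟨x.1.2, x.2⟩
  have hF : Function.Injective F := by
    rintro ⟨⟨j, i⟩, c⟩ ⟨⟨j', i'⟩, c'⟩ h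
    have hi : i = i' := by
      rw [← (φ i ⟨j, c⟩).2, ← (φ i' ⟨j', c'⟩).2]
      exact congrArg f h
    subst hi
    have h2 := (φ i).injective (Subtype.ext h)
    simp only [Sigma.mk.injEq] at h2
    obtain ⟨rfl, h2⟩ := h2
    rw [eq_of_heq h2]
  have hG : Function.Injective G := by
    rintro ⟨⟨j, i⟩, c⟩ ⟨⟨j', i'⟩, c'⟩ h
    have hj : j = j' := by
      rw [← (ψ j ⟨i, c⟩).2, ← (ψ j' ⟨i', c'⟩).2]
      exact congrArg g h
    subst hj
    have h2 := (ψ j).injective (Subtype.ext h)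
    simp only [Sigma.mk.injEq] at h2
    obtain ⟨rfl, h2⟩ := h2
    rw [eq_of_heq h2]
  obtain ⟨π, hπ⟩ := Equiv.Perm.exists_extending_pair F G hF hG
  refine ⟨π, fun j i => ?_⟩
  let E : Fin (k j i) → {p // f p = i ∧ g (π p) = j} := fun c =>
    ⟨F ⟨(j, i), c⟩, (φ i ⟨j, c⟩).2, by rw [hπ]; exact (ψ j ⟨i, c⟩).2⟩
  have hE : Function.Injective E := fun c c' h => by
    have h2 := congrArg Subtype.val h
    simpa using hF h2
  simpa using Fintype.card_le_of_injective E hE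

/-- The version of `exists_perm_card_ge` in which the permutation preserves a level function. -/
theorem exists_perm_level_card_ge [DecidableEq T] (lev : P → T) (f : P → ι) (g : P → κ)
    (k : T → κ → ι → ℕ)
    (hf : ∀ t i, ∑ j, k t j i ≤ Fintype.card {p // lev p = t ∧ f p = i})
    (hg : ∀ t j, ∑ i, k t j i ≤ Fintype.card {p // lev p = t ∧ g p = j}) :
    ∃ π : Equiv.Perm P, (∀ p, lev (π p) = lev p) ∧
      ∀ t j i, k t j i ≤ Fintype.card {p // lev p = t ∧ f p = i ∧ g (π p) = j} := by
  have h : ∀ t, ∃ π : Equiv.Perm {p // lev p = t}, ∀ j i,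
      k t j i ≤ Fintype.card {p : {p // lev p = t} // f p = i ∧ g (π p) = j} := fun t =>
    exists_perm_card_ge (fun p : {p // lev p = t} => f p) (fun p => g p) (k t)
      (fun i => (hf t i).trans_eq
        (Fintype.card_congr (Equiv.subtypeSubtypeEquivSubtypeInter _ _).symm))
      (fun j => (hg t j).trans_eq
        (Fintype.card_congr (Equiv.subtypeSubtypeEquivSubtypeInter _ _).symm))
  choose π hπ using h
  -- The permutations of the separate levels are glued together.
  let Φ : Equiv.Perm P := (Equiv.sigmaFiberEquiv lev).permCongr (Equiv.sigmaCongrRight π)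
  have hΦ : ∀ p, Φ p = π (lev p) ⟨p, rfl⟩ := fun p => rfl
  refine ⟨Φ, fun p => by rw [hΦ]; exact (π (lev p) ⟨p, rfl⟩).2, fun t j i => ?_⟩
  have hg' : ∀ p : {p // lev p = t}, Φ p = π t p := by
    rintro ⟨p, rfl⟩
    exact hΦ p
  exact (hπ t j i).trans (Fintype.card_le_of_injective
    (fun p => (⟨p.1.1, p.1.2, p.2.1, (hg' p.1).symm ▸ p.2.2⟩ :
      {p // lev p = t ∧ f p = i ∧ g (Φ p) = j}))
    fun p q h => Subtype.ext (Subtype.ext (congrArg Subtype.val h :)))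

end counting

/-! ### The reservoir -/

section reservoir

variable {σ : Type} [Fintype σ]

/-- The Boltzmann weight of `t s` quanta of weight `c s` for each `s`. -/
def levelWeight (c : σ → ℝ) (t : σ → ℕ) : ℝ := ∏ s, c s ^ t s

/-- The charge of `t s` quanta of charge `h s` for each `s`. -/
def levelCharge (h : σ → ℝ) (t : σ → ℕ) : ℝ := ∑ s, t s * h s

theorem levelWeight_pos {c : σ → ℝ} (hc : ∀ s, 0 < c s) (t : σ → ℕ) : 0 < levelWeight c t :=
  Finset.prod_pos fun s _ => pow_pos (hc s) _

theorem levelWeight_add (c : σ → ℝ) (t u : σ → ℕ) :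
    levelWeight c (t + u) = levelWeight c t * levelWeight c u := by
  simp [levelWeight, pow_add, Finset.prod_mul_distrib]

theorem levelWeight_single [DecidableEq σ] (c : σ → ℝ) (s : σ) : levelWeight c (Pi.single s 1) = c s := by
  rw [levelWeight, Fintype.prod_eq_single s]
  · simp
  · intro x hx
    simp [hx]

theorem levelCharge_add (h : σ → ℝ) (t u : σ → ℕ) :
    levelCharge h (t + u) = levelCharge h t + levelCharge h u := by
  simp [levelCharge, add_mul, Finset.sum_add_distrib]

theorem levelCharge_single [DecidableEq σ] (h : σ → ℝ) (s : σ) : levelCharge h (Pi.single s 1) = h s := by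
  rw [levelCharge, Fintype.sum_eq_single s]
  · simp
  · intro x hx
    simp [hx]

/-- The exponent is linear in the charges, so the weight is multiplicative in the quanta. -/
theorem weight_levelCharge (β μ : ℝ) (h n : σ → ℝ) (t : σ → ℕ) :
    weight β μ (levelCharge h t) (levelCharge n t) =
      levelWeight (fun s => weight β μ (h s) (n s)) t := by
  simp only [weight, levelCharge, levelWeight, ← Real.exp_nat_mul, ← Real.exp_sum]
  congr 1
  rw [Finset.mul_sum, ← Finset.sum_sub_distrib, Finset.mul_sum]
  exact Finset.sum_congr rfl fun s _ => by ring

/-- The eigenstates of a reservoir that holds at most `L` quanta of each kind, in which the level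
`v` has degeneracy `⌊K / w⌋` for its weight `w`. -/
abbrev Reservoir (c : σ → ℝ) (K : ℝ) (L : ℕ) : Type :=
  Σ v : σ → Fin (L + 1), Fin ⌊K / levelWeight c (fun s => v s)⌋₊

/-- The number of quanta in a reservoir state. -/
def Reservoir.level {c : σ → ℝ} {K : ℝ} {L : ℕ} (r : Reservoir c K L) : σ → ℕ := fun s => r.1 s

/-- Degeneracy times weight is at most `K` on each of the `(L + 1) ^ card σ` levels. -/
theorem sum_levelWeight_reservoir_le [DecidableEq σ] {c : σ → ℝ} (hc : ∀ s, 0 < c s) {K : ℝ} (hK : 0 ≤ K)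
    (L : ℕ) : ∑ r : Reservoir c K L, levelWeight c r.level ≤ K * (L + 1 : ℝ) ^ Fintype.card σ := by
  rw [Fintype.sum_sigma]
  calc ∑ v : σ → Fin (L + 1), ∑ _ : Fin ⌊K / levelWeight c (fun s => v s)⌋₊,
        levelWeight c (fun s => (v s : ℕ))
      ≤ ∑ v : σ → Fin (L + 1), K := Finset.sum_le_sum fun v _ => by
        have hw := levelWeight_pos hc (fun s => (v s : ℕ))
        rw [Finset.sum_const, Finset.card_univ, Fintype.card_fin, nsmul_eq_mul]
        calc _ ≤ K / levelWeight c (fun s => (v s : ℕ)) * levelWeight c (fun s => (v s : ℕ)) :=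
              mul_le_mul_of_nonneg_right (Nat.floor_le (div_nonneg hK hw.le)) hw.le
          _ = K := div_mul_cancel₀ _ hw.ne'
    _ = _ := by
        rw [Finset.sum_const, Finset.card_univ, Fintype.card_fun, Fintype.card_fin, nsmul_eq_mul]
        push_cast
        ring

end reservoir

/-! ### Counting joint eigenstates in a level -/

section matching

variable {ι κ : Type} [Fintype ι] [Fintype κ] [DecidableEq ι] [DecidableEq κ]

/-- The number of quanta in a joint state of the system, a copy of the target and the reservoir. -/
def jointLevel {c : ι ⊕ κ → ℝ} {K : ℝ} {L : ℕ} (p : ι × κ × Reservoir c K L) : ι ⊕ κ → ℕ :=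
  Pi.single (.inl p.1) 1 + (Pi.single (.inr p.2.1) 1 + p.2.2.level)

/-- A level in the bulk of the box is reached from every pair of eigenstates. -/
theorem exists_box_level {L : ℕ} {t : ι ⊕ κ → ℕ}
    (ht : t ∈ Fintype.piFinset fun _ => Finset.Icc 1 L) (i : ι) (j : κ) :
    ∃ v : ι ⊕ κ → Fin (L + 1),
      Pi.single (.inl i) 1 + (Pi.single (.inr j) 1 + fun s => (v s : ℕ)) = t := by
  have h : ∀ s, 1 ≤ t s ∧ t s ≤ L := fun s => Finset.mem_Icc.mp (Fintype.mem_piFinset.mp ht s)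
  refine ⟨fun s => ⟨t s - (Pi.single (.inl i) 1 + Pi.single (.inr j) 1 : ι ⊕ κ → ℕ) s,
    by have := h s; omega⟩, ?_⟩
  funext s
  have := h s
  -- The quanta of `i` and `j` are of different kinds, so at most one is removed per coordinate. As
  -- `t s ≥ 1`, the natural subtraction never truncates.
  have h1 : (Pi.single (.inl i) 1 : ι ⊕ κ → ℕ) s + (Pi.single (.inr j) 1 : ι ⊕ κ → ℕ) s ≤ 1 := by
    rcases s with a | b <;> simp [Pi.single_apply] <;> split_ifs <;> omega
  simp only [Pi.add_apply]
  omega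

variable {c : ι ⊕ κ → ℝ} {K θ : ℝ} {L : ℕ}

/-- Rounding down loses less than 1, which the spare part `(1 - θ) * x` absorbs. -/
theorem floor_ge_mul {x θ : ℝ} (hx : 1 ≤ (1 - θ) * x) : θ * x ≤ ⌊x⌋₊ := by
  have := Nat.sub_one_lt_floor x
  linarith

/-- Lower bound on the number of reservoir states on which a given pair of eigenstates reaches a
level in the bulk of the box. -/
theorem card_reservoir_ge (hc : ∀ s, 0 < c s)
    (hK : ∀ v : ι ⊕ κ → Fin (L + 1), levelWeight c (fun s => (v s : ℕ)) ≤ (1 - θ) * K)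
    {t : ι ⊕ κ → ℕ} (ht : t ∈ Fintype.piFinset fun _ => Finset.Icc 1 L) (i : ι) (j : κ) :
    θ * (K * c (.inl i) * c (.inr j) / levelWeight c t) ≤
      Fintype.card {r : Reservoir c K L // jointLevel (i, j, r) = t} := by
  obtain ⟨v, hv⟩ := exists_box_level ht i j
  have hw := levelWeight_pos hc (fun s => (v s : ℕ))
  have h1 : levelWeight c t = c (.inl i) * (c (.inr j) * levelWeight c (fun s => (v s : ℕ))) := by
    rw [← hv, levelWeight_add, levelWeight_add, levelWeight_single, levelWeight_single]
  have h2 : K * c (.inl i) * c (.inr j) / levelWeight c t =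
      K / levelWeight c (fun s => (v s : ℕ)) := by
    have := (hc (.inl i)).ne'
    have := (hc (.inr j)).ne'
    rw [h1]
    field_simp
  rw [h2]
  refine (floor_ge_mul ?_).trans (Nat.cast_le.mpr ?_)
  · rw [← mul_div_assoc, le_div_iff₀ hw, one_mul]
    exact hK v
  · let E : Fin ⌊K / levelWeight c (fun s => (v s : ℕ))⌋₊ →
        {r : Reservoir c K L // jointLevel (i, j, r) = t} := fun x => ⟨⟨v, x⟩, hv⟩
    have hE : Function.Injective E := fun x y h => by
      have := Subtype.ext_iff.mp h
      simpa [E] using this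
    simpa using Fintype.card_le_of_injective E hE

end matching

/-! ### Approximating a stochastic matrix by a level-preserving permutation -/

section transition

variable {ι κ : Type} [Fintype ι] [Fintype κ] [DecidableEq ι] [DecidableEq κ]

/-- Of the `(L + 1) ^ d` levels in the box, `L ^ d` lie in the bulk, and `(L / (L + 1)) ^ d` tends
to 1. -/
theorem exists_bulk_fraction (d : ℕ) {η : ℝ} (hη : 0 < η) :
    ∃ L : ℕ, (1 - η) * (L + 1 : ℝ) ^ d ≤ (L : ℝ) ^ d := by
  have h := (tendsto_natCast_div_add_atTop (1 : ℝ)).pow d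
  rw [one_pow] at h
  obtain ⟨L, hL⟩ := (h.eventually_const_le (show 1 - η < 1 by linarith)).exists
  refine ⟨L, ?_⟩
  rwa [div_pow, le_div_iff₀ (by positivity)] at hL

/-- Finitely many lower bounds on `K`. The first kind makes the rounding of degeneracies negligible.
The second does so for the loss of one state per transition count, whose weight is `levelWeight c t
/ c (.inl i)`. -/
theorem exists_large_bath (c : ι ⊕ κ → ℝ) {B : ℝ} (hB : 0 < B) {η : ℝ}
    (hη : 0 < η) (L : ℕ) : ∃ K : ℝ, 0 < K ∧
      (∀ v : ι ⊕ κ → Fin (L + 1), levelWeight c (fun s => (v s : ℕ)) ≤ η * K) ∧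
      ∀ t ∈ Fintype.piFinset (fun _ : ι ⊕ κ => Finset.Icc 1 L), ∀ i : ι,
        levelWeight c t / c (.inl i) ≤ η * (K * B) := by
  have h1 : ∀ x : ℝ, ∀ᶠ K in Filter.atTop, x ≤ η * K := fun x =>
    (Filter.tendsto_id.const_mul_atTop hη).eventually_ge_atTop x
  have h2 : ∀ x : ℝ, ∀ᶠ K in Filter.atTop, x ≤ η * (K * B) := fun x =>
    ((Filter.tendsto_id.atTop_mul_const hB).const_mul_atTop hη).eventually_ge_atTop x
  exact ((Filter.eventually_gt_atTop 0).and ((Filter.eventually_all.mpr fun v => h1 _).and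
    ((Filter.eventually_all_finset _).mpr fun t _ => Filter.eventually_all.mpr fun i =>
      h2 _))).exists

variable {c : ι ⊕ κ → ℝ} {K θ : ℝ} {L : ℕ}

/-- The bounds for the pairs `(i, j)` are summed over `j`; the target version sums over `i`. -/
theorem card_level_source_ge (hc : ∀ s, 0 < c s)
    (hK : ∀ v : ι ⊕ κ → Fin (L + 1), levelWeight c (fun s => (v s : ℕ)) ≤ (1 - θ) * K)
    {t : ι ⊕ κ → ℕ} (ht : t ∈ Fintype.piFinset fun _ => Finset.Icc 1 L) (i : ι) :
    θ * (K * c (.inl i) * (∑ j, c (.inr j)) / levelWeight c t) ≤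
      Fintype.card {p : ι × κ × Reservoir c K L // jointLevel p = t ∧ p.1 = i} := by
  calc θ * (K * c (.inl i) * (∑ j, c (.inr j)) / levelWeight c t)
      = ∑ j, θ * (K * c (.inl i) * c (.inr j) / levelWeight c t) := by
        rw [Finset.mul_sum, Finset.sum_div, Finset.mul_sum]
    _ ≤ ∑ j, (Fintype.card {r : Reservoir c K L // jointLevel (i, j, r) = t} : ℝ) :=
        Finset.sum_le_sum fun j _ => card_reservoir_ge hc hK ht i j
    _ = Fintype.card (Σ j, {r : Reservoir c K L // jointLevel (i, j, r) = t}) := by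
        simp
    _ ≤ _ := Nat.cast_le.mpr (Fintype.card_le_of_injective
        (fun x => ⟨(i, x.1, x.2.1), x.2.2, rfl⟩) fun x y h => by
          obtain ⟨j, r, hr⟩ := x
          obtain ⟨j', r', hr'⟩ := y
          have := Subtype.ext_iff.mp h
          simp only [Prod.mk.injEq, true_and] at this
          obtain ⟨rfl, rfl⟩ := this
          rfl)

theorem card_level_target_ge (hc : ∀ s, 0 < c s)
    (hK : ∀ v : ι ⊕ κ → Fin (L + 1), levelWeight c (fun s => (v s : ℕ)) ≤ (1 - θ) * K)
    {t : ι ⊕ κ → ℕ} (ht : t ∈ Fintype.piFinset fun _ => Finset.Icc 1 L) (j : κ) :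
    θ * (K * (∑ i, c (.inl i)) * c (.inr j) / levelWeight c t) ≤
      Fintype.card {p : ι × κ × Reservoir c K L // jointLevel p = t ∧ p.2.1 = j} := by
  calc θ * (K * (∑ i, c (.inl i)) * c (.inr j) / levelWeight c t)
      = ∑ i, θ * (K * c (.inl i) * c (.inr j) / levelWeight c t) := by
        rw [Finset.mul_sum, Finset.sum_mul, Finset.sum_div, Finset.mul_sum]
    _ ≤ ∑ i, (Fintype.card {r : Reservoir c K L // jointLevel (i, j, r) = t} : ℝ) :=
        Finset.sum_le_sum fun i _ => card_reservoir_ge hc hK ht i j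
    _ = Fintype.card (Σ i, {r : Reservoir c K L // jointLevel (i, j, r) = t}) := by
        simp
    _ ≤ _ := Nat.cast_le.mpr (Fintype.card_le_of_injective
        (fun x => ⟨(x.1, j, x.2.1), x.2.2, rfl⟩) fun x y h => by
          obtain ⟨i, r, hr⟩ := x
          obtain ⟨i', r', hr'⟩ := y
          have := Subtype.ext_iff.mp h
          simp only [Prod.mk.injEq, true_and] at this
          obtain ⟨rfl, rfl⟩ := this
          rfl)

/-- A matrix that maps Boltzmann weights to Boltzmann weights is approximated, on most levels of
the reservoir, by a permutation that preserves the level. -/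
theorem exists_perm_transition_count (hc : ∀ s, 0 < c s) (hK0 : 0 < K) (hθ : 0 ≤ θ)
    (hK : ∀ v : ι ⊕ κ → Fin (L + 1), levelWeight c (fun s => (v s : ℕ)) ≤ (1 - θ) * K)
    {M : Matrix κ ι ℝ} (h0 : ∀ j i, 0 ≤ M j i) (h1 : ∀ i, ∑ j, M j i = 1)
    (hM : ∀ j, (∑ i, M j i * c (.inl i)) * ∑ j, c (.inr j) = c (.inr j) * ∑ i, c (.inl i)) :
    ∃ π : Equiv.Perm (ι × κ × Reservoir c K L), (∀ p, jointLevel (π p) = jointLevel p) ∧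
      ∀ t ∈ Fintype.piFinset (fun _ : ι ⊕ κ => Finset.Icc 1 L), ∀ j i,
        M j i * (θ * (K * c (.inl i) * (∑ j, c (.inr j)) / levelWeight c t)) - 1 ≤
          Fintype.card {p // jointLevel p = t ∧ p.1 = i ∧ (π p).2.1 = j} := by
  classical
  set B := ∑ j, c (.inr j) with hB
  set A := ∑ i, c (.inl i) with hA
  have hB0 : 0 ≤ B := Finset.sum_nonneg fun j _ => (hc _).le
  let m : (ι ⊕ κ → ℕ) → κ → ι → ℝ := fun t j i =>
    M j i * (θ * (K * c (.inl i) * B / levelWeight c t))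
  have hm0 : ∀ t j i, 0 ≤ m t j i := fun t j i => by
    have := hc (.inl i)
    have := levelWeight_pos hc t
    have := h0 j i
    positivity
  -- Nothing is prescribed outside the bulk, where the permutation only has to preserve the level.
  let k : (ι ⊕ κ → ℕ) → κ → ι → ℕ := fun t j i =>
    if t ∈ Fintype.piFinset (fun _ : ι ⊕ κ => Finset.Icc 1 L) then ⌊m t j i⌋₊ else 0
  obtain ⟨π, hπ, hk⟩ := exists_perm_level_card_ge
    (jointLevel : ι × κ × Reservoir c K L → ι ⊕ κ → ℕ) (fun p => p.1) (fun p => p.2.1) k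
    (fun t i => by
      by_cases ht : t ∈ Fintype.piFinset (fun _ : ι ⊕ κ => Finset.Icc 1 L)
      · simp only [k, ht, if_true]
        have : ((∑ j, ⌊m t j i⌋₊ : ℕ) : ℝ) ≤
            Fintype.card {p : ι × κ × Reservoir c K L // jointLevel p = t ∧ p.1 = i} := by
          push_cast
          refine (Finset.sum_le_sum fun j _ => Nat.floor_le (hm0 t j i)).trans ?_
          rw [← Finset.sum_mul, h1, one_mul]
          exact card_level_source_ge hc hK ht i
        exact_mod_cast this
      · simp only [k, ht, if_false, Finset.sum_const_zero]
        exact Nat.zero_le _)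
    (fun t j => by
      by_cases ht : t ∈ Fintype.piFinset (fun _ : ι ⊕ κ => Finset.Icc 1 L)
      · simp only [k, ht, if_true]
        have : ((∑ i, ⌊m t j i⌋₊ : ℕ) : ℝ) ≤
            Fintype.card {p : ι × κ × Reservoir c K L // jointLevel p = t ∧ p.2.1 = j} := by
          push_cast
          refine (Finset.sum_le_sum fun i _ => Nat.floor_le (hm0 t j i)).trans ?_
          refine le_of_eq_of_le ?_ (card_level_target_ge hc hK ht j)
          -- Here preservation of equilibrium is used: it makes the demand on `j` equal to the
          -- guaranteed supply.
          calc ∑ i, m t j i = θ * K / levelWeight c t * ((∑ i, M j i * c (.inl i)) * B) := by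
                rw [Finset.sum_mul, Finset.mul_sum]
                exact Finset.sum_congr rfl fun i _ => by simp only [m]; ring
            _ = _ := by rw [hM j]; ring
        exact_mod_cast this
      · simp only [k, ht, if_false, Finset.sum_const_zero]
        exact Nat.zero_le _)
  refine ⟨π, hπ, fun t ht j i => ?_⟩
  have h2 := hk t j i
  simp only [k, ht, if_true] at h2
  exact (Nat.sub_one_lt_floor _).le.trans (Nat.cast_le.mpr h2)

theorem exists_perm_transition_ge [Nonempty ι] [Nonempty κ] (hc : ∀ s, 0 < c s)
    {M : Matrix κ ι ℝ} (h0 : ∀ j i, 0 ≤ M j i) (h1 : ∀ i, ∑ j, M j i = 1)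
    (hM : ∀ j, (∑ i, M j i * c (.inl i)) * ∑ j, c (.inr j) = c (.inr j) * ∑ i, c (.inl i))
    {δ : ℝ} (hδ : 0 < δ) :
    ∃ (K : ℝ) (L : ℕ) (π : Equiv.Perm (ι × κ × Reservoir c K L)),
      Nonempty (Reservoir c K L) ∧ (∀ p, jointLevel (π p) = jointLevel p) ∧
      ∀ j i, M j i - δ ≤
        (∑ q : κ × Reservoir c K L, c (.inr q.1) * levelWeight c q.2.level)⁻¹ *
          ∑ q : κ × Reservoir c K L with (π (i, q)).2.1 = j,
            c (.inr q.1) * levelWeight c q.2.level := by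
  -- Three losses of at most `η` each: the levels outside the bulk, the factor `θ = 1 - η`, and the
  -- `- 1` in the transition counts.
  obtain ⟨η, hη0, hη1, hηδ⟩ : ∃ η : ℝ, 0 < η ∧ η ≤ 1 ∧ 3 * η ≤ δ :=
    ⟨min (δ / 3) 1, by positivity, min_le_right _ _, by linarith [min_le_left (δ / 3) 1]⟩
  set B := ∑ j, c (.inr j) with hB
  have hB0 : 0 < B := Finset.sum_pos (fun j _ => hc _) Finset.univ_nonempty
  set d := Fintype.card (ι ⊕ κ) with hd
  obtain ⟨L, hL⟩ := exists_bulk_fraction d hη0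
  obtain ⟨K, hK0, hK, hKt⟩ := exists_large_bath c hB0 hη0 L
  have hK' : ∀ v : ι ⊕ κ → Fin (L + 1),
      levelWeight c (fun s => (v s : ℕ)) ≤ (1 - (1 - η)) * K := by simpa using hK
  obtain ⟨π, hπ, hcount⟩ :=
    exists_perm_transition_count hc hK0 (sub_nonneg.mpr hη1) hK' h0 h1 hM
  have hne : Nonempty (Reservoir c K L) := by
    have hw := levelWeight_pos hc (fun s => (((fun _ => 0 : ι ⊕ κ → Fin (L + 1)) s : Fin _) : ℕ))
    have h2 : 0 < ⌊K / levelWeight c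
        (fun s => (((fun _ => 0 : ι ⊕ κ → Fin (L + 1)) s : Fin _) : ℕ))⌋₊ := by
      rw [Nat.floor_pos, le_div_iff₀ hw, one_mul]
      exact (hK _).trans (mul_le_of_le_one_left hK0.le hη1)
    exact ⟨⟨fun _ => 0, ⟨0, h2⟩⟩⟩
  refine ⟨K, L, π, hne, hπ, fun j i => ?_⟩
  let w : κ × Reservoir c K L → ℝ := fun q => c (.inr q.1) * levelWeight c q.2.level
  have hw : ∀ q, 0 < w q := fun q => mul_pos (hc _) (levelWeight_pos hc _)
  have hZ : ∑ q, w q ≤ B * (K * (L + 1 : ℝ) ^ d) := by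
    rw [Fintype.sum_prod_type]
    simp only [w, ← Finset.mul_sum]
    rw [← Finset.sum_mul]
    exact mul_le_mul_of_nonneg_left (sum_levelWeight_reservoir_le hc hK0.le L) hB0.le
  have hZ0 : 0 < ∑ q, w q := Finset.sum_pos (fun q _ => hw q) Finset.univ_nonempty
  have hS : (L : ℝ) ^ d * ((M j i * (1 - η) - η) * (K * B)) ≤
      ∑ q with (π (i, q)).2.1 = j, w q := by
    have hci := hc (.inl i)
    calc (L : ℝ) ^ d * ((M j i * (1 - η) - η) * (K * B))
        = ∑ t ∈ Fintype.piFinset (fun _ : ι ⊕ κ => Finset.Icc 1 L),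
            ((M j i * (1 - η) - η) * (K * B)) := by
          rw [Finset.sum_const, nsmul_eq_mul, Fintype.card_piFinset, Finset.prod_const,
            Finset.card_univ, Nat.card_Icc, Nat.add_sub_cancel, Nat.cast_pow]
      _ ≤ ∑ t ∈ Fintype.piFinset (fun _ : ι ⊕ κ => Finset.Icc 1 L),
            ∑ q with (π (i, q)).2.1 = j ∧ jointLevel (i, q) = t, w q := by
          refine Finset.sum_le_sum fun t ht => ?_
          have hwt := levelWeight_pos hc t
          -- For fixed `i`, all bath states in one joint level have the same weight, so counting
          -- states amounts to summing weights.
          have hwq : ∀ q ∈ Finset.univ.filter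
              (fun q : κ × Reservoir c K L => (π (i, q)).2.1 = j ∧ jointLevel (i, q) = t),
              w q = levelWeight c t / c (.inl i) := by
            intro q hq
            rw [← (Finset.mem_filter.mp hq).2.2, jointLevel, levelWeight_add, levelWeight_add,
              levelWeight_single, levelWeight_single, mul_div_cancel_left₀ _ hci.ne']
          rw [Finset.sum_congr rfl hwq, Finset.sum_const, nsmul_eq_mul]
          have h3 : (Fintype.card {p : ι × κ × Reservoir c K L //
              jointLevel p = t ∧ p.1 = i ∧ (π p).2.1 = j} : ℝ) ≤
              (Finset.univ.filter (fun q : κ × Reservoir c K L =>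
                (π (i, q)).2.1 = j ∧ jointLevel (i, q) = t)).card := by
            rw [← Fintype.card_subtype, Nat.cast_le]
            refine Fintype.card_le_of_injective (fun p => ⟨p.1.2, ?_⟩) ?_
            · obtain ⟨⟨a, q⟩, h4, rfl, h5⟩ := p
              exact ⟨h5, h4⟩
            · rintro ⟨⟨a, q⟩, h4, rfl, h5⟩ ⟨⟨a', q'⟩, h4', h6, h5'⟩ h
              have h7 : q = q' := Subtype.ext_iff.mp h
              have h8 : a' = a := h6
              subst h7 h8
              rfl
          calc (M j i * (1 - η) - η) * (K * B)
              ≤ M j i * (1 - η) * (K * B) - levelWeight c t / c (.inl i) := by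
                linarith [hKt t ht i]
            _ = (M j i * ((1 - η) * (K * c (.inl i) * B / levelWeight c t)) - 1) *
                  (levelWeight c t / c (.inl i)) := by field_simp
            _ ≤ _ := mul_le_mul_of_nonneg_right ((hcount t ht j i).trans h3) (by positivity)
      _ ≤ ∑ q with (π (i, q)).2.1 = j, w q := by
          -- Levels outside the bulk contribute nonnegatively and are dropped.
          simp only [← Finset.filter_filter]
          exact Finset.sum_fiberwise_le_sum_of_sum_fiber_nonneg fun t _ =>
            Finset.sum_nonneg fun q _ => (hw q).le
  rw [inv_mul_eq_div, le_div_iff₀ hZ0]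
  -- The upper bound on the partition sum can be multiplied only by a nonnegative number; otherwise
  -- the claim is trivial.
  rcases le_or_gt (M j i - δ) 0 with hle | hgt
  · exact (mul_nonpos_of_nonpos_of_nonneg hle hZ0.le).trans
      (Finset.sum_nonneg fun q _ => (hw q).le)
  · have hM1 := stochastic_le_one h0 h1 j i
    refine (mul_le_mul_of_nonneg_left hZ hgt.le).trans (le_trans ?_ hS)
    have h4 : (M j i - δ) * (L + 1 : ℝ) ^ d ≤ (L : ℝ) ^ d * (M j i * (1 - η) - η) := by
      have h5 : 0 ≤ M j i * (1 - η) - η := by nlinarith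
      have h6 : M j i - δ ≤ (1 - η) * (M j i * (1 - η) - η) := by
        nlinarith [mul_nonneg hη0.le (sub_nonneg.mpr hM1), sq_nonneg η,
          mul_nonneg (sq_nonneg η) (h0 j i)]
      calc _ ≤ ((1 - η) * (M j i * (1 - η) - η)) * (L + 1 : ℝ) ^ d :=
            mul_le_mul_of_nonneg_right h6 (by positivity)
        _ = ((1 - η) * (L + 1 : ℝ) ^ d) * (M j i * (1 - η) - η) := by ring
        _ ≤ _ := mul_le_mul_of_nonneg_right hL h5
    calc (M j i - δ) * (B * (K * (L + 1 : ℝ) ^ d))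
        = ((M j i - δ) * (L + 1 : ℝ) ^ d) * (K * B) := by ring
      _ ≤ ((L : ℝ) ^ d * (M j i * (1 - η) - η)) * (K * B) :=
          mul_le_mul_of_nonneg_right h4 (by positivity)
      _ = _ := by ring

end transition

/-! ### Equimajorization implies conversion -/

section sufficiency

variable {ι κ : Type} [Fintype ι] [DecidableEq ι] [Fintype κ] [DecidableEq κ]

/-- An entrywise lower bound between vectors of equal sum is a two-sided bound. -/
theorem abs_sub_le_of_sub_le {κ : Type} [Fintype κ] {M M' : κ → ℝ} {δ : ℝ} (h : ∑ j, M j = ∑ j, M' j)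
    (hle : ∀ j, M j - δ ≤ M' j) (j : κ) : |M' j - M j| ≤ Fintype.card κ * δ := by
  have h1 : ∀ k, 0 ≤ M' k - M k + δ := fun k => by linarith [hle k]
  have h2 : ∑ k, (M' k - M k + δ) = Fintype.card κ * δ := by
    rw [Finset.sum_add_distrib, Finset.sum_sub_distrib, h]
    simp
  -- Each excess over the lower bound is nonnegative, so it is at most their sum.
  have h3 := Finset.single_le_sum (f := fun k => M' k - M k + δ) (fun k _ => h1 k)
    (Finset.mem_univ j)
  have hcard : (1 : ℝ) ≤ Fintype.card κ := by exact_mod_cast Fintype.card_pos_iff.mpr ⟨j⟩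
  rw [h2] at h3
  have h4 := h1 j
  rcases le_or_gt 0 δ with hδ | hδ
  · rw [abs_le]
    constructor <;> nlinarith
  · exfalso
    have := h4.trans h3
    nlinarith

/-- The operation approximates `M` itself and does not depend on the state vectors; only
preservation of equilibrium is used. -/
theorem Equimajorizes.exists_operation {β μ : ℝ} {R : GPState ι} {S : GPState κ}
    (B : R.Eigenbasis) (C : S.Eigenbasis) {M : Matrix κ ι ℝ} (h0 : ∀ j i, 0 ≤ M j i)
    (h1 : ∀ i, ∑ j, M j i = 1)
    (hM : M *ᵥ B.equilibriumVector β μ = C.equilibriumVector β μ) {δ : ℝ} (hδ : 0 < δ) :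
    ∃ (O : EquilibratingOperation R.toGPSystem S.toGPSystem) (M' : Matrix κ ι ℝ),
      (∀ j i, |M' j i - M j i| ≤ δ) ∧
        ∀ d, O.map β μ (ofDiag B.W d) = ofDiag C.W (M' *ᵥ d) := by
  have := R.nonempty
  have := S.nonempty
  let h : ι ⊕ κ → ℝ := Sum.elim (diagIn B.W R.H) (diagIn C.W S.H)
  let n : ι ⊕ κ → ℝ := Sum.elim (diagIn B.W R.N) (diagIn C.W S.N)
  let c : ι ⊕ κ → ℝ := fun s => weight β μ (h s) (n s)
  have hc : ∀ s, 0 < c s := fun s => weight_pos _ _ _ _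
  have hA0 : 0 < ∑ i, c (.inl i) := Finset.sum_pos (fun i _ => hc _) Finset.univ_nonempty
  have hB0 : 0 < ∑ j, c (.inr j) := Finset.sum_pos (fun i _ => hc _) Finset.univ_nonempty
  -- The equilibrium condition with both partition functions cleared.
  have hMc : ∀ j, (∑ i, M j i * c (.inl i)) * ∑ j, c (.inr j) =
      c (.inr j) * ∑ i, c (.inl i) := by
    intro j
    have h2 := congrFun hM j
    have hB : ∀ i, B.equilibriumVector β μ i = (∑ i, c (.inl i))⁻¹ * c (.inl i) :=
      B.equilibriumVector_eq β μ
    have hC : ∀ i, C.equilibriumVector β μ i = (∑ i, c (.inr i))⁻¹ * c (.inr i) :=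
      C.equilibriumVector_eq β μ
    rw [hC, Matrix.mulVec, dotProduct] at h2
    have h3 : ∑ i, M j i * B.equilibriumVector β μ i =
        (∑ i, c (.inl i))⁻¹ * ∑ i, M j i * c (.inl i) := by
      rw [Finset.mul_sum]
      exact Finset.sum_congr rfl fun i _ => by rw [hB]; ring
    rw [h3] at h2
    field_simp at h2
    linarith
  have hcard : (0 : ℝ) < Fintype.card κ := by exact_mod_cast Fintype.card_pos
  -- Passing from the entrywise lower bound to a two-sided one costs a factor `Fintype.card κ`.
  obtain ⟨K, L, π, hne, hπ, hge⟩ := exists_perm_transition_ge hc h0 h1 hMc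
    (div_pos hδ hcard)
  -- Energy and number are both functions of the joint level, so preserving the level conserves
  -- them.
  have hcharge : ∀ (f : ι ⊕ κ → ℝ) (p : ι × κ × Reservoir c K L),
      f (.inl p.1) + (f (.inr p.2.1) + levelCharge f p.2.2.level) =
        levelCharge f (jointLevel p) := by
    intro f p
    rw [jointLevel, levelCharge_add, levelCharge_add, levelCharge_single, levelCharge_single]
  obtain ⟨O, hO⟩ := exists_operation_of_perm R.toGPSystem S.toGPSystem β μ B.W_unitary
    C.W_unitary B.eq_ofDiag_H B.eq_ofDiag_N C.eq_ofDiag_H C.eq_ofDiag_N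
    (fun r : Reservoir c K L => levelCharge h r.level) (fun r => levelCharge n r.level) π
    (fun p => (hcharge h (π p)).trans ((congrArg _ (hπ p)).trans (hcharge h p).symm))
    (fun p => (hcharge n (π p)).trans ((congrArg _ (hπ p)).trans (hcharge n p).symm))
  have hw : ∀ q : κ × Reservoir c K L,
      weight β μ (diagIn C.W S.H q.1 + levelCharge h q.2.level)
        (diagIn C.W S.N q.1 + levelCharge n q.2.level) =
        c (.inr q.1) * levelWeight c q.2.level := fun q => by
    rw [weight_add, weight_levelCharge]
    rfl
  simp only [hw] at hO
  let M' : Matrix κ ι ℝ := Matrix.of fun j i =>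
    (∑ q : κ × Reservoir c K L, c (.inr q.1) * levelWeight c q.2.level)⁻¹ *
      ∑ q : κ × Reservoir c K L with (π (i, q)).2.1 = j, c (.inr q.1) * levelWeight c q.2.level
  have hM' : ∀ i, ∑ j, M' j i = 1 := by
    intro i
    simp only [M', Matrix.of_apply]
    rw [← Finset.mul_sum, Finset.sum_fiberwise]
    exact inv_mul_cancel₀ (Finset.sum_pos
      (fun q _ => mul_pos (hc _) (levelWeight_pos hc _)) Finset.univ_nonempty).ne'
  refine ⟨O, M', fun j i => ?_, fun d => ?_⟩
  · have h5 := abs_sub_le_of_sub_le (M := fun j => M j i) (M' := fun j => M' j i)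
      ((h1 i).trans (hM' i).symm) (fun j => hge j i) j
    rwa [mul_div_cancel₀ _ hcard.ne'] at h5
  · rw [hO]
    congr 1
    funext j
    exact Finset.sum_congr rfl fun i _ => mul_comm _ _

theorem continuous_ofDiag {m : Type} (W : Matrix m κ ℂ) :
    Continuous fun d : κ → ℝ => ofDiag W d := by
  have : Continuous fun d : κ → ℝ => Matrix.diagonal fun i => (d i : ℂ) :=
    Continuous.matrix_diagonal (by fun_prop)
  unfold ofDiag
  fun_prop

/-- Operations of accuracy `1 / (n + 1)` are taken; convergence of their matrices to `M` gives
convergence of the outputs, and the condition on the state vectors identifies the limit. -/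
theorem Equimajorizes.converts {β μ : ℝ} {R : GPState ι} {S : GPState κ}
    (h : Equimajorizes β μ R S) : Converts β μ R S := by
  obtain ⟨B, C, M, h0, h1, hρ, hγ⟩ := h
  choose O M' hM' hO using fun n : ℕ =>
    Equimajorizes.exists_operation (β := β) (μ := μ) B C h0 h1 hγ
      (Nat.one_div_pos_of_nat (α := ℝ) (n := n))
  refine ⟨O, ?_⟩
  have h2 : ∀ j i, Filter.Tendsto (fun n => M' n j i) Filter.atTop (nhds (M j i)) := fun j i =>
    tendsto_iff_dist_tendsto_zero.mpr (squeeze_zero (fun _ => dist_nonneg)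
      (fun n => by rw [Real.dist_eq]; exact hM' n j i) tendsto_one_div_add_atTop_nhds_zero_nat)
  have h3 : Filter.Tendsto (fun n => M' n *ᵥ B.stateVector) Filter.atTop
      (nhds (M *ᵥ B.stateVector)) :=
    tendsto_pi_nhds.mpr fun j => tendsto_finsetSum _ fun i _ => (h2 j i).mul_const _
  have h4 := ((continuous_ofDiag C.W).tendsto _).comp h3
  rw [hρ, ← C.eq_ofDiag_ρ] at h4
  refine h4.congr fun n => ?_
  rw [B.eq_ofDiag_ρ, hO, Function.comp]

end sufficiency

end GrandPotential

end

theorem theorem2 {ι κ : Type} [Fintype ι] [DecidableEq ι] [Fintype κ] [DecidableEq κ]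
    (β μ : ℝ) (R : GrandPotential.GPState ι) (S : GrandPotential.GPState κ) :
    GrandPotential.Converts β μ R S ↔ GrandPotential.Equimajorizes β μ R S :=
  ⟨fun h => h.equimajorizes, fun h => h.converts⟩
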